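/- Let $2=\{0,1\}$, let $2^{<\omega}$ be the set of finite words over $2$, and let $2^\omega$ be the Cantor space of infinite words. For $L\subseteq 2^{<\omega}$, the $\omega$-power of $L$ is $$L^\infty=\{w_0w_1w_2\cdots\in 2^\omega\mid \forall i\in\omega\ \ w_i\in L\setminus\{\emptyset\}\},$$ where $\emptyset$ denotes the empty word. Let ${\bf\Sigma}^0_1$ be the class of open subsets of $2^\omega$. For a natural number $n$ and an increasing sequence $O_0\subseteq\cdots\subseteq O_{n-1}$ of subsets of $2^\omega$, put $$D_n\big((O_i)_{i<n}\big)=\Big\{x\ \Big|\ \exists i<n\ \ i\not\equiv n\ (\mathrm{mod}\ 2)\ \text{ and }\ x\in O_i\setminus\bigcup_{j<i}O_j\Big\}.$$ Let $D_n({\bf\Sigma}^0_1)$ be the class of all sets $D_n((O_i)_{i<n})$ with $O_0\subseteq\cdots\subseteq O_{n-1}$ open, and let $\check D_n({\bf\Sigma}^0_1)$ be the class of complements of its members. For classes ${\bf\Gamma},{\bf\Lambda}$ of subsets of $2^\omega$, let $${\bf\Gamma}\oplus{\bf\Lambda}=\{(A\cap C)\cup(B\setminus C)\mid A\in{\bf\Gamma},\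 B\in{\bf\Lambda},\ C\subseteq 2^\omega\text{ clopen}\}.$$ A set $A\subseteq 2^\omega$ is complete for ${\bf\Gamma}$ if $A\in{\bf\Gamma}$ and for every $B\in{\bf\Gamma}$ there is a continuous $f:2^\omega\to 2^\omega$ with $B=f^{-1}(A)$. **Theorem.** Let $n$ be a natural number (possibly $0$). (a) There is a regular language $L\subseteq 2^{<\omega}$ such that $L^\infty$ is complete for $D_n({\bf\Sigma}^0_1)$, and there is a regular language $L\subseteq 2^{<\omega}$ such that $L^\infty$ is complete for $\check D_n({\bf\Sigma}^0_1)$. (b) There is a regular language $L\subseteq 2^{<\omega}$ such that $L^\infty$ is complete for $D_0({\bf\Sigma}^0_1)\oplus\check D_0({\bf\Sigma}^0_1)$ (this is the class of clopen sets), and there is a regular language $L\subseteq 2^{<\omega}$ such that $L^\infty$ is complete for $D_{2n+1}({\bf\Sigma}^0_1)\oplus\check D_{2n+1}({\bf\Sigma}^0_1)$. -/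

import Mathlib

namespace OmegaPower

/-- The finite word `u` is a prefix of the infinite word `σ`. -/
def IsPrefixOf {A : Type*} (u : List A) (σ : ℕ → A) : Prop :=
  ∀ (k : ℕ) (hk : k < u.length), u[k] = σ k

/-- The infinite word `σ` is the infinite concatenation `w 0 · w 1 · w 2 ⋯` of the
nonempty finite words `w i`. -/
def IsConcat {A : Type*} (w : ℕ → List A) (σ : ℕ → A) : Prop :=
  (∀ i, w i ≠ []) ∧ ∀ n : ℕ, IsPrefixOf ((List.range n).flatMap w) σ

/-- The `ω`-power of `L`: all infinite words `w 0 · w 1 · w 2 ⋯` with every `w i` in `L`.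
As the concatenation has to be infinite, empty factors may be dropped, so the `w i` are taken
to be nonempty. -/
def omegaPower {A : Type*} (L : Language A) : Set (ℕ → A) :=
  {σ | ∃ w : ℕ → List A, (∀ i, w i ∈ L) ∧ IsConcat w σ}

/-- The class of open subsets of `X`. -/
def sigma01 (X : Type*) [TopologicalSpace X] : Set (Set X) :=
  {U | IsOpen U}

/-- The dual class: complements of the members of `Γ`. -/
def dual {X : Type*} (Γ : Set (Set X)) : Set (Set X) :=
  {B | ∃ A ∈ Γ, B = Aᶜ}

/-- The difference of a finite sequence of sets: the points `x` for which the parity of the least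
`i` with `x ∈ O i` differs from the parity of `n`. -/
def diffSet {X : Type*} {n : ℕ} (O : Fin n → Set X) : Set X :=
  {x | ∃ i : Fin n, (i : ℕ) % 2 ≠ n % 2 ∧ x ∈ O i \ ⋃ j : Fin n, ⋃ _ : j < i, O j}

/-- The class of `n`-ary differences of increasing sequences of members of `Γ`. -/
def diffClass {X : Type*} (n : ℕ) (Γ : Set (Set X)) : Set (Set X) :=
  {B | ∃ O : Fin n → Set X, Monotone O ∧ (∀ i, O i ∈ Γ) ∧ B = diffSet O}

/-- The class `Γ ⊕ Λ`: sets that agree with a member of `Γ` on some clopen set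
and with a member of `Λ` off it. -/
def oplus {X : Type*} [TopologicalSpace X] (Γ Λ : Set (Set X)) : Set (Set X) :=
  {S | ∃ C A B : Set X, IsClopen C ∧ A ∈ Γ ∧ B ∈ Λ ∧ S = (A ∩ C) ∪ (B \ C)}

/-- `A` is complete for `Γ`: it belongs to `Γ`, and every member of `Γ` is
a continuous preimage of it. -/
def IsCompleteFor {X : Type*} [TopologicalSpace X] (Γ : Set (Set X)) (A : Set X) : Prop :=
  A ∈ Γ ∧ ∀ B ∈ Γ, ∃ f : X → X, Continuous f ∧ B = f ⁻¹' A

/-- The class `D_n(Σ⁰₁)` of subsets of the Cantor space. -/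
def dClass (n : ℕ) : Set (Set (ℕ → Bool)) :=
  diffClass n (sigma01 (ℕ → Bool))

end OmegaPower

open Set Filter Topology

namespace OmegaPower

/-! ### Chains of alternations between a set and its complement -/

section Alternation

variable {X Y : Type*} [TopologicalSpace X] [TopologicalSpace Y]

/-! Membership and hardness are both read off from alternating chains. A set in which no chain of
`n` alternations starts is in D_n (`mem_diffClass_of_altSet_eq_empty`); a set outside which such a
chain starts reduces every D_n set (`exists_continuous_of_mem_dClass`). Completeness for D_n thus
follows from having such chains with start outside but none with start inside. For the dual class
the roles are swapped, and for ⊕ both kinds occur, separated by a clopen set.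

Regular ω-powers with prescribed chains are built by adding letters, which lengthens chains at their
far end. `markExt` makes every old word a limit of words outside the ω-power, `acceptExt` a limit of
words inside, and the ω-power is constant near each word that uses a new letter. All points but the
last of a new chain are therefore old words, so the maximal length grows by exactly one. The last
value of the chain decides which extension applies. `HasTails` drives these arguments: after a
suitable finite prefix, a single factor can swallow letters until a tail in the ω-power is reached,
so the prefix settles membership.

The induction starts from the full space for the dual classes and from an open, non-clopen ω-power
for D_1. For ⊕ at odd index, `sumExt` joins the two examples. Oddness gives the unwanted chains a
last value that mixed words cannot newly supply: outside on one side, inside on the other. Finally,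
recoding over `Bool` is an open continuous surjection, and these preserve `altSet`. -/

/-- The points from which a chain of `k` alternations between `S` and its complement starts,
each point of the chain being a limit of its successors; `b` tells whether the starting
point lies in `S`. -/
def altSet (S : Set X) : ℕ → Bool → Set X
  | 0, b => {x | x ∈ S ↔ b = true}
  | k + 1, b => {x | x ∈ S ↔ b = true} ∩ closure (altSet S k (!b))

theorem altSet_subset (S : Set X) (k : ℕ) (b : Bool) :
    altSet S k b ⊆ {x | x ∈ S ↔ b = true} := by
  cases k with
  | zero => exact subset_rfl
  | succ k => exact inter_subset_left

theorem altSet_compl (S : Set X) (k : ℕ) (b : Bool) : altSet Sᶜ k b = altSet S k (!b) := by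
  induction k generalizing b with
  | zero => ext x; cases b <;> simp [altSet]
  | succ k ih =>
    ext x
    simp only [altSet, ih, mem_inter_iff, mem_ofPred_eq]
    cases b <;> simp

/-- Preimages under continuous open maps commute with closure. This transports chains through the
binary recoding. -/
theorem altSet_preimage {h : Y → X} (ho : IsOpenMap h) (hc : Continuous h) (S : Set X) (k : ℕ)
    (b : Bool) : altSet (h ⁻¹' S) k b = h ⁻¹' altSet S k b := by
  induction k generalizing b with
  | zero => rfl
  | succ k ih =>
    simp only [altSet, ih, preimage_inter, ho.preimage_closure_eq_closure_preimage hc]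
    rfl

theorem altSet_inter_subset_of_inter_eq {S T U : Set X} (hU : IsOpen U) (h : S ∩ U = T ∩ U)
    (k : ℕ) (b : Bool) : altSet S k b ∩ U ⊆ altSet T k b := by
  have hval : ∀ x ∈ U, x ∈ S ↔ x ∈ T := fun x hx => by
    simpa [hx] using Set.ext_iff.1 h x
  induction k generalizing b with
  | zero => rintro x ⟨hx, hxU⟩; simpa [altSet, hval x hxU] using hx
  | succ k ih =>
    rintro x ⟨⟨hx, hx'⟩, hxU⟩
    refine ⟨by simpa [hval x hxU] using hx, ?_⟩
    exact closure_mono (ih _) (hU.closure_inter ⟨hx', hxU⟩)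

theorem altSet_image_subset {e : Y → X} (he : Continuous e) (S : Set X) (k : ℕ) (b : Bool) :
    e '' altSet (e ⁻¹' S) k b ⊆ altSet S k b := by
  induction k generalizing b with
  | zero => rintro _ ⟨y, hy, rfl⟩; exact hy
  | succ k ih =>
    rintro _ ⟨y, ⟨hy, hy'⟩, rfl⟩
    exact ⟨hy, closure_mono (ih _) (image_closure_subset_closure_image he ⟨y, hy', rfl⟩)⟩

/-- The set `S` is constant near `x`. -/
def ConstNear (S : Set X) (x : X) : Prop := S ∈ 𝓝 x ∨ Sᶜ ∈ 𝓝 x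

theorem ConstNear.notMem_altSet_succ {S : Set X} {x : X} (h : ConstNear S x) (k : ℕ) (b : Bool) :
    x ∉ altSet S (k + 1) b := by
  rintro ⟨hx, hx'⟩
  have hx2 := closure_mono (altSet_subset S k (!b)) hx'
  rcases h with h | h
  · have hxS := mem_of_mem_nhds h
    obtain ⟨z, hz, hz'⟩ := mem_closure_iff_nhds.1 hx2 _ h
    cases b <;> simp_all
  · have hxS := mem_of_mem_nhds h
    obtain ⟨z, hz, hz'⟩ := mem_closure_iff_nhds.1 hx2 _ h
    cases b <;> simp_all

/-- The value at the end of a chain of `k` alternations that starts with the value `b`. -/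
def lastVal (b : Bool) (k : ℕ) : Bool := xor b k.bodd

theorem lastVal_zero (b : Bool) : lastVal b 0 = b := by simp [lastVal]

theorem lastVal_succ (b : Bool) (k : ℕ) : lastVal (!b) k = lastVal b (k + 1) := by
  simp [lastVal]

/-- Every point of a chain except the last sees both values nearby, so it lies in the range of `e`.
Deleting the last point leaves a chain in `Y`. -/
theorem altSet_succ_subset_image {e : Y → X} (he : IsClosedEmbedding e) {S : Set X}
    (hS : ∀ x ∉ range e, ConstNear S x) (k : ℕ) (b : Bool) :
    altSet S (k + 1) b ⊆ e '' altSet (e ⁻¹' S) k b := by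
  have hr : ∀ k b, altSet S (k + 1) b ⊆ range e := fun k b x hx => by
    by_contra hxe
    exact (hS x hxe).notMem_altSet_succ k b hx
  induction k generalizing b with
  | zero =>
    intro x hx
    obtain ⟨y, rfl⟩ := hr _ _ hx
    exact ⟨y, hx.1, rfl⟩
  | succ k ih =>
    intro x hx
    obtain ⟨y, rfl⟩ := hr _ _ hx
    refine ⟨y, ⟨hx.1, ?_⟩, rfl⟩
    have h := closure_mono (ih _) hx.2
    rw [he.closure_image_eq] at h
    simpa [he.injective.eq_iff] using h

/-- A chain in `Y` that ends with value `v` gains one alternation at its end, because its last point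
is a limit of points with the other value. -/
theorem altSet_image_subset_succ {e : Y → X} (he : Continuous e) {S : Set X} {v : Bool}
    (hv : ∀ y, e y ∈ closure {x | x ∈ S ↔ v = false}) (k : ℕ) (b : Bool)
    (hb : lastVal b k = v) : e '' altSet (e ⁻¹' S) k b ⊆ altSet S (k + 1) b := by
  induction k generalizing b with
  | zero =>
    rintro _ ⟨y, hy, rfl⟩
    rw [lastVal_zero] at hb
    subst hb
    refine ⟨hy, ?_⟩
    convert hv y using 2
    cases b <;> simp [altSet]
  | succ k ih =>
    rintro _ ⟨y, ⟨hy, hy'⟩, rfl⟩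
    exact ⟨hy, closure_mono (ih _ (by rw [lastVal_succ, hb]))
      (image_closure_subset_closure_image he ⟨y, hy', rfl⟩)⟩

/-- Here even the last point of the chain can be moved into the range of `e`: near the range, points
of value `v` may be replaced by points of the range with that value. Hence no length is gained. -/
theorem altSet_inter_eq_empty {e : Y → X} (he : IsClosedEmbedding e) {S U : Set X}
    (hU : IsOpen U) (hS : ∀ x ∈ U, x ∉ range e → ConstNear S x) {v : Bool}
    (hv : ∀ y, e y ∈ U → e y ∈ closure {x | x ∈ S ↔ v = true} →
      y ∈ closure {y | e y ∈ S ↔ v = true})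
    {k : ℕ} {b : Bool} (hb : lastVal b (k + 1) = v) (h : altSet (e ⁻¹' S) (k + 1) b = ∅) :
    altSet S (k + 1) b ∩ U = ∅ := by
  have key : ∀ k b, lastVal b k = v → ∀ y, e y ∈ U → e y ∈ closure (altSet S k b) →
      y ∈ closure (altSet (e ⁻¹' S) k b) := by
    intro k
    induction k with
    | zero =>
      intro b hb y hyU hy
      rw [lastVal_zero] at hb
      subst hb
      exact hv y hyU hy
    | succ k ih =>
      intro b hb y hyU hy
      have hsub : altSet S (k + 1) b ∩ U ⊆ e '' altSet (e ⁻¹' S) (k + 1) b := by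
        rintro x ⟨hx, hxU⟩
        have hxe : x ∈ range e := by
          by_contra hxe
          exact (hS x hxU hxe).notMem_altSet_succ k b hx
        obtain ⟨z, rfl⟩ := hxe
        exact ⟨z, ⟨hx.1, ih _ (by rw [lastVal_succ, hb]) z hxU hx.2⟩, rfl⟩
      have h2 := closure_mono hsub (hU.closure_inter ⟨hy, hyU⟩)
      rw [he.closure_image_eq] at h2
      simpa [he.injective.eq_iff] using h2
  rw [eq_empty_iff_forall_notMem]
  rintro x ⟨hx, hxU⟩
  have hxe : x ∈ range e := by
    by_contra hxe
    exact (hS x hxU hxe).notMem_altSet_succ k b hx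
  obtain ⟨z, rfl⟩ := hxe
  simpa [h] using key _ _ hb z hxU (subset_closure hx)

/-- The open sets are the complements of closures of chain starts; the first one that contains a
point determines whether the point lies in `S`. -/
theorem mem_diffClass_of_altSet_eq_empty {S : Set X} {n : ℕ} (h : altSet S n true = ∅) :
    S ∈ diffClass n (sigma01 X) := by
  let g : ℕ → Bool := fun i => decide (i % 2 = n % 2)
  have hg : ∀ i, (!g (i + 1)) = g i := fun i => by
    simp only [g]; rw [← decide_not, decide_eq_decide]; omega
  -- With the starting value `g i`, chains of all lengths end with the same value, so deleting the
  -- first point shows that the closures decrease.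
  let F : ℕ → Set X := fun i => closure (altSet S i (g i))
  have hF : Antitone F := antitone_nat_of_succ_le fun i => by
    refine closure_minimal ?_ isClosed_closure
    intro x hx
    have := hx.2
    rwa [hg] at this
  have hFn : F n = ∅ := by simp [F, g, h]
  -- Since `x` is in the preceding closure, the value `g i` at `x` would prolong the chain and put
  -- `x` into `F i`.
  have key : ∀ x i, x ∉ F i → (∀ j < i, x ∈ F j) → (x ∈ S ↔ g i = false) := by
    intro x i hx hj
    by_contra hne
    have hval : x ∈ S ↔ g i = true := by
      cases hgi : g i <;> simp_all
    refine hx (subset_closure ?_)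
    cases i with
    | zero => exact hval
    | succ i => exact ⟨hval, by rw [hg]; exact hj i (Nat.lt_succ_self i)⟩
  refine ⟨fun i => (F i)ᶜ, fun i j hij => compl_subset_compl.2 (hF hij),
    fun i => isClosed_closure.isOpen_compl, ?_⟩
  ext x
  have hex : ∃ i, x ∉ F i := ⟨n, by simp [hFn]⟩
  classical
  have hmin := key x (Nat.find hex) (Nat.find_spec hex) fun j hj => by
    simpa using Nat.find_min hex hj
  have hle : Nat.find hex ≤ n := Nat.find_le (by simp [hFn])
  constructor
  · intro hx
    have hgi : Nat.find hex % 2 ≠ n % 2 := by simpa [g] using hmin.1 hx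
    have hlt : Nat.find hex < n := lt_of_le_of_ne hle fun h => hgi (by rw [h])
    refine ⟨⟨_, hlt⟩, hgi, Nat.find_spec hex, ?_⟩
    simp only [mem_iUnion, not_exists]
    intro j hj hxj
    exact Nat.find_min hex hj hxj
  · rintro ⟨i, hi, hxi, hxj⟩
    have : Nat.find hex = i := by
      refine (Nat.find_eq_iff hex).2 ⟨hxi, fun j hj hxj' => hxj ?_⟩
      simp only [mem_iUnion]
      exact ⟨⟨j, hj.trans i.2⟩, hj, hxj'⟩
    rw [this] at hmin
    exact hmin.2 (by simpa [g] using hi)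

end Alternation

/-! ### Completeness from the existence and absence of chains -/

section Reduction

open PiNat

/-- The image of `z` starts at `x` and moves one step along a chain for each of the sets `O (k -
1)`, `O (k - 2)`, … that contains `z`. The cylinder of length `m` is prescribed to let the induction
control how far each move goes. -/
theorem exists_continuous_reduction {Z X : Type*} [TopologicalSpace Z] [DiscreteTopology Z]
    [TopologicalSpace X] [DiscreteTopology X] {S : Set (ℕ → X)} (O : ℕ → Set (ℕ → Z))
    (hO : Monotone O) (k : ℕ) (hopen : ∀ i < k, IsOpen (O i)) (b : Bool) (x : ℕ → X)
    (hx : x ∈ altSet S k b) (m : ℕ) :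
    ∃ f : (ℕ → Z) → (ℕ → X), Continuous f ∧ (∀ z, f z ∈ cylinder x m) ∧
      ∀ z, ∀ i ≤ k, (i = k ∨ z ∈ O i) → (∀ j < i, z ∉ O j) →
        (f z ∈ S ↔ lastVal b (k - i) = true) := by
  classical
  induction k generalizing b x m with
  | zero =>
    refine ⟨fun _ => x, continuous_const, fun _ => self_mem_cylinder x m, fun z i hi _ _ => ?_⟩
    obtain rfl : i = 0 := by omega
    have hx' : x ∈ S ↔ b = true := hx
    simpa [lastVal] using hx'
  | succ k ih =>
    have hy : ∀ l : ℕ, ∃ y ∈ altSet S k (!b), y ∈ cylinder x l := fun l => by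
      obtain ⟨y, hy, hy'⟩ := mem_closure_iff.1 hx.2 _ (isOpen_cylinder (fun _ => X) x l)
        (self_mem_cylinder x l)
      exact ⟨y, hy', hy⟩
    choose y hyS hyc using hy
    choose f hfc hfr hfv using fun l =>
      ih (fun i hi => hopen i (by omega)) (!b) (y l) (hyS l) l
    have hfx : ∀ l z, f l z ∈ cylinder x l := fun l z => by
      rw [← mem_cylinder_iff_eq.1 (hyc l)]; exact hfr l z
    have hOk := hopen k (Nat.lt_succ_self k)
    have hcyl : ∀ z ∈ O k, ∃ l, cylinder z l ⊆ O k := fun z hz => by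
      obtain ⟨V, ⟨w, l, rfl⟩, hzV, hV⟩ :=
        (isTopologicalBasis_cylinders (fun _ => Z)).exists_subset_of_mem_open hz hOk
      exact ⟨l, by rwa [mem_cylinder_iff_eq.1 hzV]⟩
    -- The length of prefix that certifies `z ∈ O k`. It is locally constant on `O k` and tends to
    -- infinity at the boundary, so moving only within the cylinder of `x` of that length keeps the
    -- map continuous.
    let d : (ℕ → Z) → ℕ := fun z => if h : z ∈ O k then Nat.find (hcyl z h) else 0
    have hd : ∀ z ∈ O k, cylinder z (d z) ⊆ O k := fun z hz => by
      simp only [d, hz, dif_pos]; exact Nat.find_spec (hcyl z hz)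
    have hd' : ∀ z ∈ O k, ∀ l, cylinder z l ⊆ O k → d z ≤ l := fun z hz l hl => by
      simp only [d, hz, dif_pos]; exact Nat.find_le hl
    have hdloc : ∀ z ∈ O k, ∀ w ∈ cylinder z (d z), d w = d z := fun z hz w hw => by
      have hwO := hd z hz hw
      have hle : d w ≤ d z := hd' w hwO _ (by rw [mem_cylinder_iff_eq.1 hw]; exact hd z hz)
      refine le_antisymm hle (hd' z hz _ ?_)
      have : z ∈ cylinder w (d w) :=
        cylinder_anti w hle ((mem_cylinder_comm z w _).1 hw)
      rw [mem_cylinder_iff_eq.1 this]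
      exact hd w hwO
    refine ⟨fun z => if z ∈ O k then f (max m (d z)) z else x, ?_, ?_, ?_⟩
    · rw [continuous_iff_continuousAt]
      intro z
      by_cases hz : z ∈ O k
      · have : (fun w => if w ∈ O k then f (max m (d w)) w else x) =ᶠ[𝓝 z]
            f (max m (d z)) := by
          filter_upwards [(isOpen_cylinder (fun _ => Z) z (d z)).mem_nhds
            (self_mem_cylinder z _)] with w hw
          rw [if_pos (hd z hz hw), hdloc z hz w hw]
        exact (hfc _).continuousAt.congr this.symm
      · rw [ContinuousAt, if_neg hz, tendsto_pi_nhds]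
        intro j
        refine tendsto_nhds_of_eventually_eq ?_
        filter_upwards [(isOpen_cylinder (fun _ => Z) z (j + 1)).mem_nhds
            (self_mem_cylinder z _)] with w hw
        split_ifs with hwO
        · have hj : j < d w := by
            by_contra hj
            refine hz (hd w hwO ?_)
            exact cylinder_anti w (by omega) ((mem_cylinder_comm z w _).1 hw)
          exact hfx (max m (d w)) w j (lt_of_lt_of_le hj (le_max_right _ _))
        · rfl
    · intro z
      dsimp only
      split_ifs
      · exact cylinder_anti x (le_max_left _ _) (hfx _ z)
      · exact self_mem_cylinder x m
    · intro z i hi hzi hj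
      dsimp only
      by_cases hz : z ∈ O k
      · rw [if_pos hz]
        have hik : i ≤ k := by
          by_contra h
          exact hj k (by omega) hz
        rw [hfv _ z i hik (Or.inr (hzi.elim (fun h => by omega) id)) hj, lastVal_succ,
          show k - i + 1 = k + 1 - i by omega]
      · rw [if_neg hz]
        obtain rfl : i = k + 1 := by
          rcases hzi with h | h
          · exact h
          · by_contra hne
            exact hz (hO (by omega : i ≤ k) h)
        simpa [lastVal] using hx.1

theorem exists_continuous_of_mem_dClass {S B : Set (ℕ → Bool)} {n : ℕ}
    (hS : (altSet S n false).Nonempty) (hB : B ∈ dClass n) :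
    ∃ f : (ℕ → Bool) → (ℕ → Bool), Continuous f ∧ B = f ⁻¹' S := by
  classical
  obtain ⟨O, hmono, hopen, rfl⟩ := hB
  obtain ⟨x, hx⟩ := hS
  -- The value `univ` from `n` on gives every point a least index; index `n` means that no `O i`
  -- contains it.
  let P : ℕ → Set (ℕ → Bool) := fun i => if h : i < n then O ⟨i, h⟩ else univ
  have hP : ∀ i (h : i < n), P i = O ⟨i, h⟩ := fun i h => dif_pos h
  have hPmono : Monotone P := fun i j hij => by
    by_cases hj : j < n
    · rw [hP j hj, hP i (by omega)]
      exact hmono hij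
    · simp [P, hj]
  obtain ⟨f, hf, -, hfv⟩ := exists_continuous_reduction P hPmono n
    (fun i hi => by rw [hP i hi]; exact hopen _) false x hx 0
  refine ⟨f, hf, ?_⟩
  ext z
  have hex : ∃ i, z ∈ P i := ⟨n, by simp [P]⟩
  have hle : Nat.find hex ≤ n := Nat.find_le (by simp [P])
  have hval := hfv z (Nat.find hex) hle (Or.inr (Nat.find_spec hex))
    (fun j hj => Nat.find_min hex hj)
  rw [mem_preimage, hval]
  have hpar : lastVal false (n - Nat.find hex) = true ↔ Nat.find hex % 2 ≠ n % 2 := by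
    have h1 := Nat.mod_two_of_bodd (n - Nat.find hex)
    rw [lastVal, Bool.false_xor]
    cases h : (n - Nat.find hex).bodd <;> simp [h] at h1 ⊢ <;> omega
  rw [hpar]
  constructor
  · rintro ⟨i, hi, hzi, hzj⟩
    have : Nat.find hex = i := by
      refine (Nat.find_eq_iff hex).2 ⟨by rwa [hP i i.2], fun j hj hzj' => hzj ?_⟩
      simp only [mem_iUnion]
      rw [hP j (hj.trans i.2)] at hzj'
      exact ⟨⟨j, hj.trans i.2⟩, hj, hzj'⟩
    rwa [this]
  · intro hne
    have hlt : Nat.find hex < n := lt_of_le_of_ne hle fun h => hne (by rw [h])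
    refine ⟨⟨_, hlt⟩, hne, by rw [← hP]; exact Nat.find_spec hex, ?_⟩
    simp only [mem_iUnion, not_exists]
    intro j hj hzj
    exact Nat.find_min hex hj (by rwa [hP j j.2])

theorem isCompleteFor_dClass {S : Set (ℕ → Bool)} {n : ℕ} (h : (altSet S n false).Nonempty)
    (h' : altSet S n true = ∅) : IsCompleteFor (dClass n) S :=
  ⟨mem_diffClass_of_altSet_eq_empty h', fun _ => exists_continuous_of_mem_dClass h⟩

theorem isCompleteFor_dual_dClass {S : Set (ℕ → Bool)} {n : ℕ}
    (h : (altSet S n true).Nonempty) (h' : altSet S n false = ∅) :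
    IsCompleteFor (dual (dClass n)) S := by
  have hc : IsCompleteFor (dClass n) Sᶜ :=
    isCompleteFor_dClass (by simpa [altSet_compl] using h) (by simpa [altSet_compl] using h')
  refine ⟨⟨Sᶜ, hc.1, (compl_compl S).symm⟩, ?_⟩
  rintro _ ⟨A, hA, rfl⟩
  obtain ⟨f, hf, rfl⟩ := hc.2 A hA
  exact ⟨f, hf, by simp⟩

theorem isCompleteFor_oplus {S C : Set (ℕ → Bool)} {n : ℕ} (hC : IsClopen C)
    (ht : (altSet S n true).Nonempty) (hf : (altSet S n false).Nonempty)
    (ht' : altSet S n true ∩ C = ∅) (hf' : altSet S n false ∩ Cᶜ = ∅) :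
    IsCompleteFor (oplus (dClass n) (dual (dClass n))) S := by
  classical
  -- A chain that starts inside `T ∩ D` starts in the open set `D`, where it can be compared with a
  -- chain for `T`.
  have local_empty : ∀ (T D : Set (ℕ → Bool)), IsClopen D → altSet T n true ∩ D = ∅ →
      altSet (T ∩ D) n true = ∅ := fun T D hD hT => by
    rw [eq_empty_iff_forall_notMem] at hT ⊢
    intro x hx
    by_cases hxD : x ∈ D
    · exact hT x ⟨altSet_inter_subset_of_inter_eq hD.isOpen (by simp [inter_assoc]) n true
        ⟨hx, hxD⟩, hxD⟩
    · have := (altSet_subset _ _ _ hx).2 rfl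
      exact hxD this.2
  constructor
  · refine ⟨C, S ∩ C, (Sᶜ ∩ Cᶜ)ᶜ, hC,
      mem_diffClass_of_altSet_eq_empty (local_empty _ _ hC ht'),
      ⟨Sᶜ ∩ Cᶜ, mem_diffClass_of_altSet_eq_empty (local_empty _ _ hC.compl ?_), rfl⟩, ?_⟩
    · simpa [altSet_compl] using hf'
    · ext x; by_cases hx : x ∈ C <;> simp [hx]
  · rintro _ ⟨D, A, B, hD, hA, ⟨B, hB, rfl⟩, rfl⟩
    obtain ⟨f, hf, rfl⟩ := exists_continuous_of_mem_dClass hf hA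
    obtain ⟨g, hg, rfl⟩ := exists_continuous_of_mem_dClass (S := Sᶜ)
      (by simpa [altSet_compl] using ht) hB
    refine ⟨D.piecewise f g, ?_, ?_⟩
    · refine hf.piecewise ?_ hg
      simp [hD.frontier_eq]
    · ext x; by_cases hx : x ∈ D <;> simp [hx]

end Reduction

/-! ### Factorizations of infinite words -/

section Words

variable {A B : Type*}

/-- The prefix of length `m` of an infinite word. -/
def pre (σ : ℕ → A) (m : ℕ) : List A := (List.range m).map σ

/-- The infinite word that remains when the first `m` letters are dropped. -/
def tl (σ : ℕ → A) (m : ℕ) : ℕ → A := fun i => σ (m + i)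

@[simp] theorem length_pre (σ : ℕ → A) (m : ℕ) : (pre σ m).length = m := by simp [pre]

@[simp] theorem tl_apply (σ : ℕ → A) (m i : ℕ) : tl σ m i = σ (m + i) := rfl

@[simp] theorem tl_zero (σ : ℕ → A) : tl σ 0 = σ := by ext; simp

theorem tl_tl (σ : ℕ → A) (m k : ℕ) : tl (tl σ m) k = tl σ (m + k) := by
  ext; simp [add_assoc]

theorem getElem_pre (σ : ℕ → A) (m i : ℕ) (h : i < (pre σ m).length) : (pre σ m)[i] = σ i := by
  simp [pre]

theorem pre_succ (σ : ℕ → A) (m : ℕ) : pre σ (m + 1) = σ 0 :: pre (tl σ 1) m := by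
  simp [pre, List.range_succ_eq_map, add_comm, Function.comp_def]

theorem pre_succ_append (σ : ℕ → A) (m : ℕ) : pre σ (m + 1) = pre σ m ++ [σ m] := by
  simp [pre, List.range_succ]

theorem pre_add (σ : ℕ → A) (m k : ℕ) : pre σ (m + k) = pre σ m ++ pre (tl σ m) k := by
  simp [pre, List.range_add, Function.comp_def]

theorem map_pre (p : A → B) (σ : ℕ → A) (m : ℕ) : (pre σ m).map p = pre (p ∘ σ) m := by
  simp [pre]

theorem mem_pre {σ : ℕ → A} {m : ℕ} {a : A} : a ∈ pre σ m ↔ ∃ i < m, σ i = a := by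
  simp [pre]

theorem pre_congr {σ τ : ℕ → A} {m : ℕ} (h : ∀ i < m, σ i = τ i) : pre σ m = pre τ m := by
  simpa [pre] using h

theorem isPrefixOf_iff {u : List A} {σ : ℕ → A} : IsPrefixOf u σ ↔ pre σ u.length = u := by
  constructor
  · intro h
    refine List.ext_getElem (by simp) fun i h1 h2 => ?_
    rw [getElem_pre, h i h2]
  · intro h k hk
    rw [← getElem_pre σ u.length k (by simpa using hk)]
    simp [h]

theorem isPrefixOf_append {u v : List A} {σ : ℕ → A} :
    IsPrefixOf (u ++ v) σ ↔ IsPrefixOf u σ ∧ IsPrefixOf v (tl σ u.length) := by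
  simp only [isPrefixOf_iff, List.length_append, pre_add]
  refine ⟨fun h => List.append_inj h (by simp), fun h => by rw [h.1, h.2]⟩

theorem flatMap_range_succ (w : ℕ → List A) (n : ℕ) :
    (List.range (n + 1)).flatMap w = w 0 ++ (List.range n).flatMap fun i => w (i + 1) := by
  simp [List.range_succ_eq_map, List.flatMap_map]

theorem mem_omegaPower_iff {L : Language A} {σ : ℕ → A} :
    σ ∈ omegaPower L ↔ ∃ m, 0 < m ∧ pre σ m ∈ L ∧ tl σ m ∈ omegaPower L := by
  constructor
  · rintro ⟨w, hw, hne, hpre⟩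
    have h1 : IsPrefixOf (w 0) σ := by simpa [flatMap_range_succ] using hpre 1
    refine ⟨(w 0).length, List.length_pos_iff.2 (hne 0), ?_, fun i => w (i + 1),
      fun i => hw _, fun i => hne _, fun n => ?_⟩
    · rw [isPrefixOf_iff.1 h1]; exact hw 0
    · have := hpre (n + 1)
      rw [flatMap_range_succ, isPrefixOf_append] at this
      exact this.2
  · rintro ⟨m, hm, hL, w, hw, hne, hpre⟩
    refine ⟨fun i => Nat.casesOn i (pre σ m) w, fun i => ?_, fun i => ?_, fun n => ?_⟩
    · cases i <;> simp [hL, hw]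
    · cases i
      · rw [← List.length_pos_iff]; simpa using hm
      · exact hne _
    · cases n with
      | zero => simp [IsPrefixOf]
      | succ n =>
        rw [flatMap_range_succ, isPrefixOf_append]
        exact ⟨by simp [isPrefixOf_iff], by simpa using hpre n⟩

/-- Coinduction: a factor can be split off again and again without leaving `P`. -/
theorem subset_omegaPower {L : Language A} {P : Set (ℕ → A)}
    (h : ∀ σ ∈ P, ∃ m, 0 < m ∧ pre σ m ∈ L ∧ tl σ m ∈ P) : P ⊆ omegaPower L := by
  choose! m hm hL hP using h
  intro σ hσ
  let step : (ℕ → A) → ℕ → A := fun τ => tl τ (m τ)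
  have hit : ∀ i, step^[i] σ ∈ P := fun i => by
    induction i with
    | zero => exact hσ
    | succ i ih => rw [Function.iterate_succ_apply']; exact hP _ ih
  refine ⟨fun i => pre (step^[i] σ) (m (step^[i] σ)), fun i => hL _ (hit i), fun i => ?_, ?_⟩
  · rw [← List.length_pos_iff]; simpa using hm _ (hit i)
  · intro n
    clear hit hσ
    induction n generalizing σ with
    | zero => simp [IsPrefixOf]
    | succ n ih =>
      rw [flatMap_range_succ, isPrefixOf_append]
      refine ⟨by simp [isPrefixOf_iff], ?_⟩
      simpa [step] using ih (σ := step σ)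

/-- Every infinite word has a tail in the `ω`-power of `L`. -/
def HasTails (L : Language A) : Prop := ∀ σ : ℕ → A, ∃ k, tl σ k ∈ omegaPower L

end Words

/-! ### Recoding finite alphabets in binary -/

section Coding

theorem omegaPower_comap {A B : Type*} (p : B → A) (L : Language A) :
    omegaPower (List.map p ⁻¹' L : Set (List B)) = {σ | p ∘ σ ∈ omegaPower L} := by
  apply Subset.antisymm
  · have h : ((fun σ => p ∘ σ) '' omegaPower (List.map p ⁻¹' L : Set (List B))) ⊆
        omegaPower L := by
      apply subset_omegaPower
      rintro _ ⟨σ, hσ, rfl⟩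
      obtain ⟨m, hm, hL, ht⟩ := mem_omegaPower_iff.1 hσ
      exact ⟨m, hm, by rw [← map_pre]; exact hL, _, ht, rfl⟩
    exact fun σ hσ => h ⟨σ, hσ, rfl⟩
  · apply subset_omegaPower
    intro σ hσ
    obtain ⟨m, hm, hL, ht⟩ := mem_omegaPower_iff.1 hσ
    refine ⟨m, hm, ?_, ht⟩
    change (pre σ m).map p ∈ L
    rwa [map_pre]

/-- Every `ω`-power of a regular language over `A` is, up to a continuous open surjection,
the `ω`-power of a regular language over `B`. -/
def Encodes (B A : Type) [TopologicalSpace B] [TopologicalSpace A] : Prop :=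
  ∃ h : (ℕ → B) → (ℕ → A), Continuous h ∧ IsOpenMap h ∧ Function.Surjective h ∧
    ∀ L : Language A, L.IsRegular → ∃ L' : Language B, L'.IsRegular ∧
      omegaPower L' = h ⁻¹' omegaPower L

theorem Encodes.trans {A B C : Type} [TopologicalSpace A] [TopologicalSpace B]
    [TopologicalSpace C] (h1 : Encodes C B) (h2 : Encodes B A) : Encodes C A := by
  obtain ⟨f, hfc, hfo, hfs, hf⟩ := h1
  obtain ⟨g, hgc, hgo, hgs, hg⟩ := h2
  refine ⟨g ∘ f, hgc.comp hfc, hgo.comp hfo, hgs.comp hfs, fun L hL => ?_⟩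
  obtain ⟨L', hL', hg'⟩ := hg L hL
  obtain ⟨L'', hL'', hf'⟩ := hf L' hL'
  exact ⟨L'', hL'', by rw [hf', hg']; rfl⟩

theorem encodes_of_surjective {A B : Type} [TopologicalSpace A] [DiscreteTopology A]
    [TopologicalSpace B] [DiscreteTopology B] {p : B → A} (hp : Function.Surjective p) :
    Encodes B A := by
  refine ⟨fun σ => p ∘ σ, continuous_pi fun i => continuous_of_discreteTopology.comp
    (continuous_apply i), ?_, hp.comp_left, fun L hL => ?_⟩
  · exact IsOpenMap.piMap (f := fun _ : ℕ => p) (fun _ => fun _ _ => isOpen_discrete _)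
      (Eventually.of_forall fun _ => hp)
  · obtain ⟨σ, hσ, M, rfl⟩ := hL
    exact ⟨(M.comap p).accepts, ⟨σ, hσ, _, rfl⟩, by rw [M.accepts_comap, omegaPower_comap]; rfl⟩

/-- The word over `A` spelled by a word of pairs. -/
def unpair {A : Type*} (w : List (A × A)) : List A := w.flatMap fun p => [p.1, p.2]

@[simp] theorem length_unpair {A : Type*} (w : List (A × A)) :
    (unpair w).length = 2 * w.length := by
  induction w with
  | nil => rfl
  | cons a w ih => simp [unpair] at ih ⊢; omega

theorem unpair_injective {A : Type*} : Function.Injective (unpair (A := A)) := by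
  intro u
  induction u with
  | nil =>
    intro v h
    have := congrArg List.length h
    simp only [length_unpair, List.length_nil] at this
    exact (List.length_eq_zero_iff.1 (by omega)).symm
  | cons a u ih =>
    rintro (_ | ⟨b, v⟩) h
    · simp [unpair] at h
    · simp only [unpair, List.flatMap_cons, List.cons_append, List.nil_append,
        List.cons.injEq] at h
      rw [ih h.2.2, Prod.ext h.1 h.2.1]

/-- The automaton that reads letters two at a time. -/
def pairDFA {A σ : Type*} (M : DFA (A × A) σ) : DFA A (σ × Option A) where
  step q a := match q with
    | (s, none) => (s, some a)
    | (s, some b) => (M.step s (b, a), none)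
  start := (M.start, none)
  accept := {q | q.1 ∈ M.accept ∧ q.2 = none}

/-- The option `o` is the last letter while it still awaits its partner. -/
theorem exists_eval_pairDFA {A σ : Type*} (M : DFA (A × A) σ) (u : List A) :
    ∃ w o, u = unpair w ++ Option.toList o ∧ (pairDFA M).eval u = (M.eval w, o) := by
  induction u using List.reverseRecOn with
  | nil => exact ⟨[], none, rfl, rfl⟩
  | append_singleton u a ih =>
    obtain ⟨w, o, hu, hev⟩ := ih
    rw [DFA.eval_append_singleton, hev]
    cases o with
    | none => exact ⟨w, some a, by simp [hu], rfl⟩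
    | some b =>
      exact ⟨w ++ [(b, a)], none, by simp [hu, unpair], by simp [pairDFA]⟩

theorem accepts_pairDFA {A σ : Type*} (M : DFA (A × A) σ) :
    (pairDFA M).accepts = (unpair '' M.accepts : Set (List A)) := by
  ext u
  obtain ⟨w, o, hu, hev⟩ := exists_eval_pairDFA M u
  rw [DFA.mem_accepts, hev]
  constructor
  · rintro ⟨h, ho⟩
    obtain rfl : o = none := ho
    exact ⟨w, h, by simp [hu]⟩
  · rintro ⟨v, hv, hvu⟩
    have ho : o = none := by
      cases o with
      | none => rfl
      | some b =>
        have := congrArg List.length (hvu.trans hu)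
        simp at this
        omega
    subst ho
    have : v = w := unpair_injective (by simpa [hu] using hvu)
    subst this
    exact ⟨hv, rfl⟩

/-- Reading an infinite word two letters at a time. -/
def pairUp (A : Type*) [TopologicalSpace A] : (ℕ → A) ≃ₜ (ℕ → A × A) where
  toFun σ n := (σ (2 * n), σ (2 * n + 1))
  invFun τ n := if n % 2 = 0 then (τ (n / 2)).1 else (τ (n / 2)).2
  left_inv σ := by
    ext n
    dsimp only
    split_ifs with h <;> congr 1 <;> omega
  right_inv τ := by
    ext n
    · simp
    · have : (2 * n + 1) / 2 = n := by omega
      simp [this, Nat.add_mod]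
  continuous_toFun := by fun_prop
  continuous_invFun := continuous_pi fun n => by
    split_ifs <;> fun_prop

theorem unpair_pre_pairUp {A : Type*} [TopologicalSpace A] (σ : ℕ → A) (k : ℕ) :
    unpair (pre (pairUp A σ) k) = pre σ (2 * k) := by
  induction k with
  | zero => rfl
  | succ k ih =>
    rw [pre_succ_append, unpair, List.flatMap_append, ← unpair, ih, mul_add, mul_one,
      pre_succ_append, pre_succ_append]
    simp [pairUp]

theorem tl_pairUp {A : Type*} [TopologicalSpace A] (σ : ℕ → A) (k : ℕ) :
    tl (pairUp A σ) k = pairUp A (tl σ (2 * k)) := by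
  ext n <;> simp [pairUp, mul_add, add_assoc]

theorem encodes_pair (A : Type) [TopologicalSpace A] [Finite A] : Encodes A (A × A) := by
  refine ⟨pairUp A, (pairUp A).continuous, (pairUp A).isOpenMap, (pairUp A).surjective,
    fun L hL => ?_⟩
  obtain ⟨σ, hσ, M, rfl⟩ := hL
  have := Fintype.ofFinite A
  refine ⟨(pairDFA M).accepts, ⟨_, inferInstance, _, rfl⟩, ?_⟩
  rw [accepts_pairDFA]
  apply Subset.antisymm
  · have h : (pairUp A '' omegaPower (unpair '' M.accepts : Set (List A))) ⊆
        omegaPower M.accepts := by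
      apply subset_omegaPower
      rintro _ ⟨σ, hσ, rfl⟩
      obtain ⟨m, hm, ⟨w, hw, hwm⟩, ht⟩ := mem_omegaPower_iff.1 hσ
      have hlen : m = 2 * w.length := by
        simpa using (congrArg List.length hwm).symm
      subst hlen
      rw [← unpair_pre_pairUp] at hwm
      refine ⟨w.length, by omega, ?_, ?_⟩
      · rwa [← unpair_injective hwm]
      · rw [tl_pairUp]; exact ⟨_, ht, rfl⟩
    exact fun σ hσ => h ⟨σ, hσ, rfl⟩
  · apply subset_omegaPower
    intro σ hσ
    obtain ⟨m, hm, hL, ht⟩ := mem_omegaPower_iff.1 hσ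
    exact ⟨2 * m, by omega, ⟨_, hL, unpair_pre_pairUp σ m⟩, by
      rwa [tl_pairUp] at ht⟩

theorem exists_large_encodes (n : ℕ) : ∃ (T : Type) (_ : TopologicalSpace T)
    (_ : DiscreteTopology T) (_ : Finite T), Encodes Bool T ∧ n + 2 ≤ Nat.card T := by
  induction n with
  | zero =>
    exact ⟨Bool, inferInstance, inferInstance, inferInstance,
      encodes_of_surjective Function.surjective_id, by simp⟩
  | succ n ih =>
    obtain ⟨T, _, _, _, hT, hcard⟩ := ih
    refine ⟨T × T, inferInstance, inferInstance, inferInstance, hT.trans (encodes_pair T), ?_⟩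
    rw [Nat.card_prod]
    nlinarith

/-- Repeated squaring of `Bool` gives an alphabet at least as large as `A`; surplus letters are
decoded arbitrarily. -/
theorem encodes_bool (A : Type) [TopologicalSpace A] [DiscreteTopology A] [Finite A]
    [Nonempty A] : Encodes Bool A := by
  obtain ⟨T, _, _, _, hT, hcard⟩ := exists_large_encodes (Nat.card A)
  have := Fintype.ofFinite A
  have := Fintype.ofFinite T
  obtain ⟨f⟩ := Function.Embedding.nonempty_of_card_le (α := A) (β := T)
    (by rw [Nat.card_eq_fintype_card, Nat.card_eq_fintype_card] at hcard; omega)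
  exact hT.trans (encodes_of_surjective (Function.invFun_surjective f.injective))

end Coding

/-! ### Neighbourhoods and closures in terms of prefixes -/

section Sequences

variable {A B : Type*} [TopologicalSpace A] [DiscreteTopology A]

theorem mem_nhds_iff_pre {x : ℕ → A} {S : Set (ℕ → A)} :
    S ∈ 𝓝 x ↔ ∃ n, ∀ y : ℕ → A, (∀ i < n, y i = x i) → y ∈ S := by
  constructor
  · intro h
    obtain ⟨V, ⟨w, n, rfl⟩, hxV, hV⟩ :=
      (PiNat.isTopologicalBasis_cylinders (fun _ => A)).mem_nhds_iff.1 h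
    exact ⟨n, fun y hy => hV fun i hi => (hy i hi).trans (hxV i hi)⟩
  · rintro ⟨n, hn⟩
    exact mem_of_superset ((PiNat.isOpen_cylinder (fun _ => A) x n).mem_nhds
      (PiNat.self_mem_cylinder x n)) fun y hy => hn y hy

theorem mem_closure_iff_pre {x : ℕ → A} {S : Set (ℕ → A)} :
    x ∈ closure S ↔ ∀ n, ∃ y ∈ S, ∀ i < n, y i = x i := by
  rw [mem_closure_iff_nhds]
  constructor
  · intro h n
    obtain ⟨y, hy, hyS⟩ := h {y | ∀ i < n, y i = x i} (mem_nhds_iff_pre.2 ⟨n, fun _ h => h⟩)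
    exact ⟨y, hyS, hy⟩
  · intro h t ht
    obtain ⟨n, hn⟩ := mem_nhds_iff_pre.1 ht
    obtain ⟨y, hyS, hy⟩ := h n
    exact ⟨y, hn y hy, hyS⟩

theorem constNear_of_forall {x : ℕ → A} {S : Set (ℕ → A)} (n : ℕ)
    (h : ∀ y, (∀ i < n, y i = x i) → (y ∈ S ↔ x ∈ S)) : ConstNear S x := by
  by_cases hx : x ∈ S
  · exact Or.inl (mem_nhds_iff_pre.2 ⟨n, fun y hy => (h y hy).2 hx⟩)
  · exact Or.inr (mem_nhds_iff_pre.2 ⟨n, fun y hy => mt (h y hy).1 hx⟩)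

theorem isClosedEmbedding_comp [TopologicalSpace B] [DiscreteTopology B] {f : B → A}
    (hf : Function.Injective f) :
    IsClosedEmbedding (fun y : ℕ → B => (f ∘ y : ℕ → A)) := by
  exact IsClosedEmbedding.piMap fun _ => .of_continuous_injective_isClosedMap
    continuous_of_discreteTopology hf fun _ _ => isClosed_discrete _

theorem isClopen_first (p : A → Prop) : IsClopen {x : ℕ → A | p (x 0)} :=
  (isClopen_discrete {a | p a}).preimage (continuous_apply 0)

end Sequences

/-! ### Automata for the languages used -/

section Regular

variable {A B : Type*}

/-- The words whose first letter satisfies `p` and is followed by a word of `L`. -/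
def consLang (p : A → Prop) (L : Language A) : Language A :=
  {w | ∃ x, ∃ v ∈ L, p x ∧ w = x :: v}

/-- The words that contain a letter satisfying `p`. -/
def containsLang (p : A → Prop) : Language A := {w | ∃ x ∈ w, p x}

/-- The letterwise image of `L`. -/
def imageLang (f : A → B) (L : Language A) : Language B := {w | ∃ u ∈ L, w = u.map f}

/-- The words that continue the letterwise image of a word of `L` by a letter outside the range
of `f`, or not at all. -/
def imageAppendLang (f : A → B) (L : Language A) : Language B :=
  {w | (∃ u ∈ L, w = u.map f) ∨ ∃ u x v, u ∈ L ∧ x ∉ range f ∧ w = u.map f ++ x :: v}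

theorem isRegular_consLang (p : A → Prop) {L : Language A} (hL : L.IsRegular) :
    (consLang p L).IsRegular := by
  classical
  obtain ⟨σ, _, M, rfl⟩ := hL
  let N : DFA A (σ ⊕ Bool) :=
    { step := fun s x => match s with
        | .inl s => .inl (M.step s x)
        | .inr true => if p x then .inl M.start else .inr false
        | .inr false => .inr false
      start := .inr true
      accept := Sum.inl '' M.accept }
  have h1 : ∀ s w, N.evalFrom (.inl s) w = .inl (M.evalFrom s w) := fun s w => by
    induction w generalizing s with
    | nil => rfl
    | cons a w ih => exact ih _
  have h2 : ∀ w, N.evalFrom (.inr false) w = .inr false := fun w => by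
    induction w with
    | nil => rfl
    | cons a w ih => exact ih
  refine ⟨_, inferInstance, N, ?_⟩
  ext w
  rw [DFA.mem_accepts]
  cases w with
  | nil =>
    constructor
    · rintro ⟨s, -, h⟩; cases h
    · rintro ⟨x, v, -, -, h⟩; cases h
  | cons x v =>
    have h3 : N.eval (x :: v) = N.evalFrom (if p x then .inl M.start else .inr false) v := rfl
    rw [h3]
    split_ifs with hx
    · rw [h1]
      constructor
      · rintro ⟨s, hs, hs'⟩
        rw [Sum.inl.injEq] at hs'
        subst hs'
        exact ⟨x, v, hs, hx, rfl⟩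
      · rintro ⟨x, v, hv, -, h⟩
        rw [List.cons.injEq] at h
        rw [h.2]
        exact ⟨_, hv, rfl⟩
    · rw [h2]
      constructor
      · rintro ⟨s, hs, hs'⟩; cases hs'
      · rintro ⟨x, v, hv, hx', h⟩
        rw [List.cons.injEq] at h
        exact absurd (h.1 ▸ hx') hx

theorem isRegular_containsLang (p : A → Prop) : (containsLang p).IsRegular := by
  classical
  let N : DFA A Bool :=
    { step := fun s x => s || decide (p x)
      start := false
      accept := {true} }
  refine ⟨_, inferInstance, N, ?_⟩
  ext w
  rw [DFA.mem_accepts]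
  have : ∀ s w, N.evalFrom s w = true ↔ s = true ∨ ∃ x ∈ w, p x := fun s w => by
    induction w generalizing s with
    | nil => simp
    | cons a w ih =>
      rw [DFA.evalFrom_cons, ih]
      simp [N, or_assoc]
  exact (this false w).trans (or_iff_right Bool.false_ne_true)

theorem isRegular_top : (⊤ : Language A).IsRegular := by
  refine ⟨Unit, inferInstance, ⟨fun s _ => s, (), univ⟩, ?_⟩
  ext w
  exact iff_of_true trivial trivial

/-- The automaton that runs `M` on the letters decoded by `q`, and decides by `acc` at the first
letter that has no decoding. -/
def partialDFA {σ : Type*} (M : DFA A σ) (q : B → Option A) (acc : σ → Bool) :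
    DFA B (σ ⊕ Bool) where
  step s x := match s with
    | .inl s => match q x with
      | some a => .inl (M.step s a)
      | none => .inr (acc s)
    | .inr v => .inr v
  start := .inl M.start
  accept := Sum.inl '' M.accept ∪ {.inr true}

/-- The states `.inr v` are sinks, so the verdict at the first undecodable letter is final. -/
theorem accepts_partialDFA {σ : Type*} (M : DFA A σ) {q : B → Option A} {f : A → B}
    (hq : ∀ x a, q x = some a ↔ x = f a) (acc : σ → Bool) :
    (partialDFA M q acc).accepts = ({w | (∃ u ∈ M.accepts, w = u.map f) ∨
      ∃ u x v, acc (M.eval u) = true ∧ q x = none ∧ w = u.map f ++ x :: v} : Set (List B)) := by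
  set N := partialDFA M q acc with hN
  have h0 : ∀ v w, N.evalFrom (.inr v) w = .inr v := fun v w => by
    induction w with
    | nil => rfl
    | cons a w ih => exact ih
  have h1 : ∀ u, N.eval (u.map f) = .inl (M.eval u) := fun u => by
    induction u using List.reverseRecOn with
    | nil => rfl
    | append_singleton u a ih =>
      rw [List.map_append, List.map_singleton, DFA.eval_append_singleton, ih,
        DFA.eval_append_singleton]
      simp [hN, partialDFA, (hq (f a) a).2 rfl]
  have h2 : ∀ u x v, q x = none → N.eval (u.map f ++ x :: v) = .inr (acc (M.eval u)) :=
    fun u x v hx => by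
      rw [DFA.eval, DFA.evalFrom_of_append, ← DFA.eval, h1, DFA.evalFrom_cons]
      have : N.step (.inl (M.eval u)) x = .inr (acc (M.eval u)) := by
        simp [hN, partialDFA, hx]
      rw [this, h0]
  have h3 : ∀ w : List B, (∃ u : List A, w = u.map f) ∨
      ∃ (u : List A) (x : B) (v : List B), q x = none ∧ w = u.map f ++ x :: v := fun w => by
    induction w with
    | nil => exact Or.inl ⟨[], rfl⟩
    | cons x w ih =>
      cases hx : q x with
      | none => exact Or.inr ⟨[], x, w, hx, rfl⟩
      | some a =>
        rw [hq] at hx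
        subst hx
        rcases ih with ⟨u, rfl⟩ | ⟨u, y, v, hy, rfl⟩
        · exact Or.inl ⟨a :: u, rfl⟩
        · exact Or.inr ⟨a :: u, y, v, hy, rfl⟩
  ext w
  rw [DFA.mem_accepts]
  constructor
  · intro hw
    rcases h3 w with ⟨u, rfl⟩ | ⟨u, x, v, hx, rfl⟩
    · rw [h1] at hw
      rcases hw with ⟨s, hs, h⟩ | h
      · rw [Sum.inl.injEq] at h
        subst h
        exact Or.inl ⟨u, hs, rfl⟩
      · cases h
    · rw [h2 u x v hx] at hw
      rcases hw with ⟨s, hs, h⟩ | h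
      · cases h
      · exact Or.inr ⟨u, x, v, Sum.inr.inj h, hx, rfl⟩
  · rintro (⟨u, hu, rfl⟩ | ⟨u, x, v, hu, hx, rfl⟩)
    · rw [h1]; exact Or.inl ⟨_, hu, rfl⟩
    · rw [h2 u x v hx, hu]; exact Or.inr rfl

theorem isRegular_imageLang {q : B → Option A} {f : A → B}
    (hq : ∀ x a, q x = some a ↔ x = f a) {L : Language A} (hL : L.IsRegular) :
    (imageLang f L).IsRegular := by
  obtain ⟨σ, _, M, rfl⟩ := hL
  refine ⟨_, inferInstance, partialDFA M q fun _ => false, ?_⟩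
  rw [accepts_partialDFA M hq]
  ext w
  constructor
  · rintro (h | ⟨u, x, v, h, -⟩)
    · exact h
    · cases h
  · exact Or.inl

theorem isRegular_imageAppendLang {q : B → Option A} {f : A → B}
    (hq : ∀ x a, q x = some a ↔ x = f a) {L : Language A} (hL : L.IsRegular) :
    (imageAppendLang f L).IsRegular := by
  classical
  obtain ⟨σ, _, M, rfl⟩ := hL
  refine ⟨_, inferInstance, partialDFA M q fun s => decide (s ∈ M.accept), ?_⟩
  rw [accepts_partialDFA M hq]
  ext w
  have hr : ∀ x, q x = none ↔ x ∉ range f := fun x => by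
    rw [Option.eq_none_iff_forall_ne_some]
    simp only [ne_eq, hq, mem_range, not_exists, eq_comm]
  refine or_congr Iff.rfl ?_
  simp only [decide_eq_true_eq, hr]
  rfl

end Regular

/-! ### Words over a disjoint union of alphabets -/

variable {A B : Type}

theorem getLeft?_eq_some (x : A ⊕ B) (a : A) : x.getLeft? = some a ↔ x = Sum.inl a := by
  cases x <;> simp

theorem getRight?_eq_some (x : A ⊕ B) (b : B) : x.getRight? = some b ↔ x = Sum.inr b := by
  cases x <;> simp

/-- An infinite word over `A`, read over the larger alphabet `A ⊕ B`. -/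
def inlSeq (B : Type) (y : ℕ → A) : ℕ → A ⊕ B := Sum.inl ∘ y

/-- An infinite word over `B`, read over the larger alphabet `A ⊕ B`. -/
def inrSeq (A : Type) (y : ℕ → B) : ℕ → A ⊕ B := Sum.inr ∘ y

theorem mem_range_inlSeq {x : ℕ → A ⊕ B} : x ∈ range (inlSeq B) ↔ ∀ i, (x i).isLeft := by
  constructor
  · rintro ⟨y, rfl⟩ i; rfl
  · intro h
    choose y hy using fun i => Sum.isLeft_iff.1 (h i)
    exact ⟨y, funext fun i => (hy i).symm⟩

theorem mem_range_inrSeq {x : ℕ → A ⊕ B} : x ∈ range (inrSeq A) ↔ ∀ i, (x i).isRight := by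
  constructor
  · rintro ⟨y, rfl⟩ i; rfl
  · intro h
    choose y hy using fun i => Sum.isRight_iff.1 (h i)
    exact ⟨y, funext fun i => (hy i).symm⟩

theorem isRight_of_pre_eq_map {x : ℕ → A ⊕ B} {m : ℕ} {u : List B}
    (h : pre x m = u.map Sum.inr) {i : ℕ} (hi : i < m) : (x i).isRight := by
  have : x i ∈ u.map Sum.inr := h ▸ mem_pre.2 ⟨i, hi, rfl⟩
  obtain ⟨b, -, hb⟩ := List.mem_map.1 this
  rw [← hb]; rfl

theorem isLeft_of_pre_eq_map {x : ℕ → A ⊕ B} {m : ℕ} {u : List A}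
    (h : pre x m = u.map Sum.inl) {i : ℕ} (hi : i < m) : (x i).isLeft := by
  have : x i ∈ u.map Sum.inl := h ▸ mem_pre.2 ⟨i, hi, rfl⟩
  obtain ⟨b, -, hb⟩ := List.mem_map.1 this
  rw [← hb]; rfl

theorem omegaPower_congr {L L' : Language A} (h : ∀ u ≠ [], u ∈ L ↔ u ∈ L') :
    omegaPower L = omegaPower L' := by
  ext σ
  exact exists_congr fun w => and_congr_left fun hw => forall_congr' fun i => h _ (hw.1 i)

theorem comp_mem_omegaPower_iff {p : A → B} {L : Language A} {L' : Language B}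
    (h : ∀ u ≠ [], u.map p ∈ L' ↔ u ∈ L) (y : ℕ → A) :
    p ∘ y ∈ omegaPower L' ↔ y ∈ omegaPower L := by
  rw [← omegaPower_congr (L := (List.map p ⁻¹' L' : Set (List A))) h, omegaPower_comap]
  rfl

/-! ### Two new letters: limits of words outside the ω-power -/

section Mark

/-- The words that start with the second marker, or with the first marker not followed by
the second one. -/
def markStart (A : Type) : Language (A ⊕ Bool) :=
  consLang (· = Sum.inr true) ⊤ + consLang (· = Sum.inr false) (consLang (· ≠ Sum.inr true) ⊤)

/-- The extension of `L` by two new letters, under which every word over `A` becomes a limit of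
words outside the `ω`-power. -/
def markExt (L : Language A) : Language (A ⊕ Bool) :=
  imageLang Sum.inl L + markStart A

theorem isRegular_markExt {L : Language A} (hL : L.IsRegular) : (markExt L).IsRegular :=
  (isRegular_imageLang getLeft?_eq_some hL).add <| (isRegular_consLang _ isRegular_top).add
    (isRegular_consLang _ (isRegular_consLang _ isRegular_top))

/-- The condition on infinite words that corresponds to `markStart`. -/
def MarkStart (x : ℕ → A ⊕ Bool) : Prop :=
  x 0 = Sum.inr true ∨ x 0 = Sum.inr false ∧ x 1 ≠ Sum.inr true

theorem pre_mem_markStart {x : ℕ → A ⊕ Bool} (hx : MarkStart x) (m : ℕ) :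
    pre x (m + 2) ∈ markStart A := by
  rw [pre_succ, pre_succ]
  rcases hx with hx | ⟨hx, hx'⟩
  · exact Or.inl ⟨_, _, trivial, hx, rfl⟩
  · exact Or.inr ⟨_, _, ⟨_, _, trivial, hx', rfl⟩, hx, rfl⟩

theorem markStart_of_pre_mem {x : ℕ → A ⊕ Bool} {m : ℕ} (h : pre x m ∈ markStart A) :
    MarkStart x := by
  cases m with
  | zero => rcases h with ⟨_, _, _, _, h⟩ | ⟨_, _, _, _, h⟩ <;> cases h
  | succ m =>
    rw [pre_succ] at h
    rcases h with ⟨y, v, -, rfl, h⟩ | ⟨y, v, ⟨z, w, -, hz, rfl⟩, rfl, h⟩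
    · exact Or.inl (List.cons.inj h).1
    · rw [List.cons.injEq] at h
      refine Or.inr ⟨h.1, ?_⟩
      cases m with
      | zero => cases h.2
      | succ m =>
        rw [pre_succ] at h
        rw [← (List.cons.inj h.2).1] at hz
        exact hz

theorem map_inl_mem_markExt {L : Language A} (u : List A) :
    u.map Sum.inl ∈ markExt L ↔ u ∈ L := by
  constructor
  · rintro (⟨v, hv, h⟩ | ⟨x, v, -, hx, h⟩ | ⟨x, v, -, hx, h⟩)
    · rwa [List.map_injective_iff.2 Sum.inl_injective h]
    all_goals cases u <;> cases hx <;> cases h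
  · exact fun hu => Or.inl ⟨u, hu, rfl⟩

theorem inlSeq_mem_omegaPower_markExt {L : Language A} (y : ℕ → A) :
    inlSeq Bool y ∈ omegaPower (markExt L) ↔ y ∈ omegaPower L :=
  comp_mem_omegaPower_iff (fun u _ => map_inl_mem_markExt u) y

theorem inlSeq_preimage_markExt (L : Language A) :
    inlSeq Bool ⁻¹' omegaPower (markExt L) = omegaPower L :=
  Set.ext inlSeq_mem_omegaPower_markExt

/-- If `MarkStart` holds at infinitely many positions, the word is cut there. Otherwise the second
marker eventually disappears, hence so does the first, and a tail over `A` remains. -/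
theorem HasTails.markExt {L : Language A} (hL : HasTails L) : HasTails (markExt L) := by
  intro x
  by_cases hx : ∀ N, ∃ k ≥ N, MarkStart (tl x k)
  · have h : {x : ℕ → A ⊕ Bool | MarkStart x ∧ ∀ N, ∃ k ≥ N, MarkStart (tl x k)} ⊆
        omegaPower (OmegaPower.markExt L) := by
      apply subset_omegaPower
      rintro x ⟨hx, hx'⟩
      -- The factor needs length at least two, so as to contain both letters that `MarkStart` may
      -- inspect.
      obtain ⟨k, hk, hkx⟩ := hx' 2
      refine ⟨k, by omega, Or.inr ?_, hkx, fun N => ?_⟩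
      · have := pre_mem_markStart hx (k - 2)
        rwa [Nat.sub_add_cancel hk] at this
      · obtain ⟨j, hj, hjx⟩ := hx' (k + N)
        refine ⟨j - k, by omega, ?_⟩
        rwa [tl_tl, Nat.add_sub_cancel' (by omega)]
    obtain ⟨k, -, hk⟩ := hx 0
    refine ⟨k, h ⟨hk, fun N => ?_⟩⟩
    obtain ⟨j, hj, hjx⟩ := hx (k + N)
    refine ⟨j - k, by omega, ?_⟩
    rwa [tl_tl, Nat.add_sub_cancel' (by omega)]
  · push Not at hx
    obtain ⟨N, hN⟩ := hx
    have htrue : ∀ k ≥ N, x k ≠ Sum.inr true := fun k hk h => hN k hk (Or.inl (by simpa using h))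
    have hl : ∀ k ≥ N, (x k).isLeft := fun k hk => by
      rcases hxk : x k with a | (_ | _)
      · rfl
      · refine absurd (Or.inr ⟨by simpa using hxk, ?_⟩) (hN k hk)
        simpa using htrue (k + 1) (by omega)
      · exact absurd hxk (htrue k hk)
    obtain ⟨y, hy⟩ := mem_range_inlSeq.2 fun i => hl (N + i) (by omega)
    obtain ⟨k, hk⟩ := hL y
    refine ⟨N + k, ?_⟩
    rw [← inlSeq_mem_omegaPower_markExt] at hk
    have hy' : inlSeq Bool y = tl x N := hy
    rw [← tl_tl, ← hy']
    exact hk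

theorem MarkStart.mem_omegaPower {L : Language A} (hL : HasTails L) {x : ℕ → A ⊕ Bool}
    (hx : MarkStart x) : x ∈ omegaPower (markExt L) := by
  obtain ⟨k, hk⟩ := hL.markExt (tl x 2)
  rw [tl_tl, add_comm] at hk
  exact mem_omegaPower_iff.2 ⟨k + 2, by omega, Or.inr (pre_mem_markStart hx k), hk⟩

/-- Either the first factor is a word over `A`, which ends by position `k`, and induction applies to
the rest; or it begins with a marker, and then its first two letters alone force membership. The
bound `k + 2` covers the letter after the marker. -/
theorem mem_omegaPower_markExt_congr {L : Language A} (hL : HasTails L) (k : ℕ)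
    (x x' : ℕ → A ⊕ Bool) (hk : (x k).isRight) (heq : ∀ i < k + 2, x' i = x i)
    (hx : x ∈ omegaPower (markExt L)) : x' ∈ omegaPower (markExt L) := by
  induction k using Nat.strong_induction_on generalizing x x' with
  | _ k ih =>
    obtain ⟨m, hm, hmL | hmL, ht⟩ := mem_omegaPower_iff.1 hx
    · obtain ⟨u, hu, hum⟩ := hmL
      have hmk : m ≤ k := by
        by_contra h
        have := isLeft_of_pre_eq_map hum (i := k) (by omega)
        cases hxk : x k <;> simp_all
      refine mem_omegaPower_iff.2 ⟨m, hm, Or.inl ⟨u, hu, ?_⟩, ?_⟩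
      · rw [← hum]; exact pre_congr fun i hi => heq i (by omega)
      · refine ih (k - m) (by omega) (tl x m) _ ?_ (fun i hi => heq _ (by omega)) ht
        simpa [Nat.add_sub_cancel' hmk] using hk
    · refine MarkStart.mem_omegaPower hL ?_
      have := markStart_of_pre_mem hmL
      rwa [MarkStart, ← heq 0 (by omega), ← heq 1 (by omega)] at this

/-- No factor can contain the first marker at `k`: one over `A` cannot, and one from `markStart`
would have to begin there, which the following second marker forbids. -/
theorem notMem_omegaPower_markExt {L : Language A} (k : ℕ) (x : ℕ → A ⊕ Bool)
    (hl : ∀ i < k, (x i).isLeft) (hk : x k = Sum.inr false) (hk' : x (k + 1) = Sum.inr true) :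
    x ∉ omegaPower (markExt L) := by
  induction k using Nat.strong_induction_on generalizing x with
  | _ k ih =>
    intro hx
    obtain ⟨m, hm, hmL | hmL, ht⟩ := mem_omegaPower_iff.1 hx
    · obtain ⟨u, hu, hum⟩ := hmL
      have hmk : m ≤ k := by
        by_contra h
        have := isLeft_of_pre_eq_map hum (i := k) (by omega)
        simp_all
      refine ih (k - m) (by omega) (tl x m) (fun i hi => hl _ (by omega)) ?_ ?_ ht
      · simpa [Nat.add_sub_cancel' hmk] using hk
      · simpa [← add_assoc, Nat.add_sub_cancel' hmk] using hk'
    · have := markStart_of_pre_mem hmL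
      cases k with
      | zero => simp_all [MarkStart]
      | succ k =>
        have h0 := hl 0 (by omega)
        rcases this with h | ⟨h, -⟩ <;> simp [h] at h0

variable [TopologicalSpace A] [DiscreteTopology A]

theorem constNear_markExt {L : Language A} (hL : HasTails L) {x : ℕ → A ⊕ Bool}
    (hx : x ∉ range (inlSeq Bool)) : ConstNear (omegaPower (markExt L)) x := by
  rw [mem_range_inlSeq] at hx
  push Not at hx
  obtain ⟨k, hk⟩ := hx
  replace hk : (x k).isRight := by simpa using hk
  refine constNear_of_forall (k + 2) fun y hy => ⟨?_, ?_⟩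
  · exact mem_omegaPower_markExt_congr hL k y x (by rwa [hy k (by omega)])
      fun i hi => (hy i hi).symm
  · exact mem_omegaPower_markExt_congr hL k x y hk hy

theorem inlSeq_mem_closure_compl_markExt {L : Language A} (y : ℕ → A) :
    inlSeq Bool y ∈ closure {x | x ∈ omegaPower (markExt L) ↔ true = false} := by
  rw [mem_closure_iff_pre]
  intro n
  -- After `n` letters of `y` comes the first marker, at position `n`, and then only the second one:
  -- the forbidden pattern.
  refine ⟨fun i => if i < n then Sum.inl (y i) else Sum.inr (decide (n < i)), ?_, ?_⟩
  · refine iff_of_false (notMem_omegaPower_markExt n _ ?_ ?_ ?_) (by simp)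
    · intro i hi; simp [hi]
    · simp
    · simp
  · intro i hi; simp [hi, inlSeq]

theorem isClosedEmbedding_inlSeq [TopologicalSpace B] [DiscreteTopology B] :
    IsClosedEmbedding (inlSeq B : (ℕ → A) → _) := isClosedEmbedding_comp Sum.inl_injective

end Mark

/-! ### One new letter: limits of words inside the ω-power -/

section Accept

/-- The extension of `L` by a new letter, under which every word that contains it is
in the `ω`-power. -/
def acceptExt (L : Language A) : Language (A ⊕ Unit) :=
  imageLang Sum.inl L + containsLang fun x => x.isRight = true

theorem isRegular_acceptExt {L : Language A} (hL : L.IsRegular) : (acceptExt L).IsRegular :=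
  (isRegular_imageLang getLeft?_eq_some hL).add (isRegular_containsLang _)

theorem map_inl_mem_acceptExt {L : Language A} (u : List A) :
    u.map Sum.inl ∈ acceptExt L ↔ u ∈ L := by
  constructor
  · rintro (⟨v, hv, h⟩ | ⟨x, hx, h⟩)
    · rwa [List.map_injective_iff.2 Sum.inl_injective h]
    · obtain ⟨a, -, rfl⟩ := List.mem_map.1 hx
      cases h
  · exact fun hu => Or.inl ⟨u, hu, rfl⟩

theorem inlSeq_mem_omegaPower_acceptExt {L : Language A} (y : ℕ → A) :
    inlSeq Unit y ∈ omegaPower (acceptExt L) ↔ y ∈ omegaPower L :=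
  comp_mem_omegaPower_iff (fun u _ => map_inl_mem_acceptExt u) y

theorem inlSeq_preimage_acceptExt (L : Language A) :
    inlSeq Unit ⁻¹' omegaPower (acceptExt L) = omegaPower L :=
  Set.ext inlSeq_mem_omegaPower_acceptExt

theorem HasTails.acceptExt {L : Language A} (hL : HasTails L) : HasTails (acceptExt L) := by
  intro x
  by_cases hx : ∀ N, ∃ k ≥ N, (x k).isRight = true
  · refine ⟨0, ?_⟩
    rw [tl_zero]
    have h : {x : ℕ → A ⊕ Unit | ∀ N, ∃ k ≥ N, (x k).isRight = true} ⊆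
        omegaPower (OmegaPower.acceptExt L) := by
      apply subset_omegaPower
      intro x hx
      obtain ⟨k, -, hk⟩ := hx 0
      refine ⟨k + 1, by omega, Or.inr ⟨x k, mem_pre.2 ⟨k, by omega, rfl⟩, hk⟩, fun N => ?_⟩
      obtain ⟨j, hj, hjx⟩ := hx (k + 1 + N)
      refine ⟨j - (k + 1), by omega, ?_⟩
      rwa [tl_apply, Nat.add_sub_cancel' (by omega)]
    exact h hx
  · push Not at hx
    obtain ⟨N, hN⟩ := hx
    obtain ⟨y, hy⟩ := mem_range_inlSeq.2 fun i => by simpa using hN (N + i) (by omega)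
    obtain ⟨k, hk⟩ := hL y
    refine ⟨N + k, ?_⟩
    rw [← inlSeq_mem_omegaPower_acceptExt] at hk
    have hy' : inlSeq Unit y = tl x N := hy
    rw [← tl_tl, ← hy']
    exact hk

/-- The first factor runs past the new letter until a tail in the ω-power begins. -/
theorem mem_omegaPower_acceptExt {L : Language A} (hL : HasTails L) {x : ℕ → A ⊕ Unit} {k : ℕ}
    (hk : (x k).isRight = true) : x ∈ omegaPower (acceptExt L) := by
  obtain ⟨j, hj⟩ := hL.acceptExt (tl x (k + 1))
  rw [tl_tl] at hj
  exact mem_omegaPower_iff.2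
    ⟨k + 1 + j, by omega, Or.inr ⟨x k, mem_pre.2 ⟨k, by omega, rfl⟩, hk⟩, hj⟩

theorem mem_omegaPower_acceptExt_of_notMem_range {L : Language A} (hL : HasTails L)
    {x : ℕ → A ⊕ Unit} (hx : x ∉ range (inlSeq Unit)) : x ∈ omegaPower (acceptExt L) := by
  rw [mem_range_inlSeq] at hx
  push Not at hx
  obtain ⟨k, hk⟩ := hx
  exact mem_omegaPower_acceptExt hL (k := k) (by simpa using hk)

variable [TopologicalSpace A] [DiscreteTopology A]

theorem constNear_acceptExt {L : Language A} (hL : HasTails L) {x : ℕ → A ⊕ Unit}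
    (hx : x ∉ range (inlSeq Unit)) : ConstNear (omegaPower (acceptExt L)) x := by
  refine Or.inl (mem_of_superset (isClosedEmbedding_inlSeq.isClosed_range.isOpen_compl.mem_nhds hx)
    fun y hy => mem_omegaPower_acceptExt_of_notMem_range hL hy)

theorem inlSeq_mem_closure_acceptExt {L : Language A} (hL : HasTails L) (y : ℕ → A) :
    inlSeq Unit y ∈ closure {x | x ∈ omegaPower (acceptExt L) ↔ false = false} := by
  rw [mem_closure_iff_pre]
  intro n
  refine ⟨fun i => if i < n then Sum.inl (y i) else Sum.inr (), ?_, ?_⟩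
  · exact iff_of_true (mem_omegaPower_acceptExt hL (k := n) (by simp)) rfl
  · intro i hi; simp [hi, inlSeq]

end Accept

/-! ### Joining two ω-powers over disjoint alphabets -/

section Sum

/-- A language on the union of two alphabets. Its `ω`-power contains every word that starts in
`A` and later meets `B`; a word that starts in `B` and later meets `A` is in the `ω`-power if
the part before the first letter of `A` is a product of words of `LB`. -/
def sumExt (LA : Language A) (LB : Language B) : Language (A ⊕ B) :=
  imageLang Sum.inl LA + (consLang (fun x => x.isRight = true) ⊤ ⊓ imageAppendLang Sum.inr LB) +
    (consLang (fun x => x.isLeft = true) ⊤ ⊓ containsLang fun x => x.isRight = true)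

theorem isRegular_sumExt {LA : Language A} {LB : Language B} (hA : LA.IsRegular)
    (hB : LB.IsRegular) : (sumExt LA LB).IsRegular :=
  ((isRegular_imageLang getLeft?_eq_some hA).add ((isRegular_consLang _ isRegular_top).inf
    (isRegular_imageAppendLang getRight?_eq_some hB))).add
      ((isRegular_consLang _ isRegular_top).inf (isRegular_containsLang _))

/-- The condition on the first letter in the middle summand matters when `LB` contains the empty
word: it keeps words that start in `A` out of that summand. -/
theorem map_inl_mem_sumExt {LA : Language A} {LB : Language B} (u : List A) :
    u.map Sum.inl ∈ sumExt LA LB ↔ u ∈ LA := by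
  constructor
  · rintro ((⟨v, hv, h⟩ | ⟨⟨x, v, -, hx, h⟩, -⟩) | ⟨-, x, hx, h⟩)
    · rwa [List.map_injective_iff.2 Sum.inl_injective h]
    · cases u
      · cases h
      · rw [List.map_cons, List.cons.injEq] at h
        rw [← h.1] at hx
        cases hx
    · obtain ⟨a, -, rfl⟩ := List.mem_map.1 hx
      cases h
  · exact fun hu => Or.inl (Or.inl ⟨u, hu, rfl⟩)

theorem map_inr_mem_sumExt {LA : Language A} {LB : Language B} (u : List B) (hu : u ≠ []) :
    u.map Sum.inr ∈ sumExt LA LB ↔ u ∈ LB := by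
  obtain ⟨b, u, rfl⟩ := List.exists_cons_of_ne_nil hu
  constructor
  · rintro ((⟨v, hv, h⟩ | ⟨-, ⟨v, hv, h⟩ | ⟨v, x, w, -, hx, h⟩⟩) | ⟨⟨x, v, -, hx, h⟩, -⟩)
    · cases v <;> cases h
    · rwa [List.map_injective_iff.2 Sum.inr_injective h]
    · have hmem : x ∈ (b :: u).map (Sum.inr : B → A ⊕ B) := by rw [h]; simp
      obtain ⟨c, -, rfl⟩ := List.mem_map.1 hmem
      exact absurd ⟨c, rfl⟩ hx
    · rw [List.map_cons, List.cons.injEq] at h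
      rw [← h.1] at hx
      cases hx
  · exact fun h => Or.inl (Or.inr ⟨⟨_, _, trivial, rfl, rfl⟩, Or.inl ⟨_, h, rfl⟩⟩)

theorem inlSeq_preimage_sumExt (LA : Language A) (LB : Language B) :
    inlSeq B ⁻¹' omegaPower (sumExt LA LB) = omegaPower LA :=
  Set.ext (comp_mem_omegaPower_iff fun u _ => map_inl_mem_sumExt u)

theorem inrSeq_preimage_sumExt (LA : Language A) (LB : Language B) :
    inrSeq A ⁻¹' omegaPower (sumExt LA LB) = omegaPower LB :=
  Set.ext (comp_mem_omegaPower_iff map_inr_mem_sumExt)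

theorem pre_mem_sumExt_of_isLeft {LA : Language A} {LB : Language B} {x : ℕ → A ⊕ B} {k m : ℕ}
    (h0 : (x 0).isLeft = true) (hk : (x k).isRight = true) (hm : k < m) :
    pre x m ∈ sumExt LA LB := by
  refine Or.inr ⟨?_, x k, mem_pre.2 ⟨k, hm, rfl⟩, hk⟩
  cases m with
  | zero => omega
  | succ m => rw [pre_succ]; exact ⟨_, _, trivial, h0, rfl⟩

/-- If both alphabets recur forever, cuts are made at letters of `A` with a letter of `B` in
between. Otherwise some tail uses only one alphabet. -/
theorem HasTails.sumExt {LA : Language A} {LB : Language B} (hA : HasTails LA)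
    (hB : HasTails LB) : HasTails (sumExt LA LB) := by
  intro x
  by_cases hr : ∀ N, ∃ k ≥ N, (x k).isRight = true
  · by_cases hl : ∀ N, ∃ k ≥ N, (x k).isLeft = true
    · have h : {x : ℕ → A ⊕ B | (x 0).isLeft = true ∧ (∀ N, ∃ k ≥ N, (x k).isRight = true) ∧
          ∀ N, ∃ k ≥ N, (x k).isLeft = true} ⊆ omegaPower (OmegaPower.sumExt LA LB) := by
        apply subset_omegaPower
        rintro x ⟨h0, hr, hl⟩
        obtain ⟨k, -, hk⟩ := hr 0
        obtain ⟨j, hj, hjl⟩ := hl (k + 1)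
        refine ⟨j, by omega, pre_mem_sumExt_of_isLeft h0 hk hj, hjl, fun N => ?_, fun N => ?_⟩
        · obtain ⟨i, hi, hx⟩ := hr (j + N)
          exact ⟨i - j, by omega, by rwa [tl_apply, Nat.add_sub_cancel' (by omega)]⟩
        · obtain ⟨i, hi, hx⟩ := hl (j + N)
          exact ⟨i - j, by omega, by rwa [tl_apply, Nat.add_sub_cancel' (by omega)]⟩
      obtain ⟨j, -, hj⟩ := hl 0
      refine ⟨j, h ⟨hj, fun N => ?_, fun N => ?_⟩⟩
      · obtain ⟨i, hi, hx⟩ := hr (j + N)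
        exact ⟨i - j, by omega, by rwa [tl_apply, Nat.add_sub_cancel' (by omega)]⟩
      · obtain ⟨i, hi, hx⟩ := hl (j + N)
        exact ⟨i - j, by omega, by rwa [tl_apply, Nat.add_sub_cancel' (by omega)]⟩
    · push Not at hl
      obtain ⟨N, hN⟩ := hl
      obtain ⟨y, hy⟩ := mem_range_inrSeq.2 fun i => by simpa using hN (N + i) (by omega)
      obtain ⟨k, hk⟩ := hB y
      refine ⟨N + k, ?_⟩
      rw [← inrSeq_preimage_sumExt LA LB] at hk
      have hy' : inrSeq A y = tl x N := hy
      rw [← tl_tl, ← hy']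
      exact hk
  · push Not at hr
    obtain ⟨N, hN⟩ := hr
    obtain ⟨y, hy⟩ := mem_range_inlSeq.2 fun i => by simpa using hN (N + i) (by omega)
    obtain ⟨k, hk⟩ := hA y
    refine ⟨N + k, ?_⟩
    rw [← inlSeq_preimage_sumExt LA LB] at hk
    have hy' : inlSeq B y = tl x N := hy
    rw [← tl_tl, ← hy']
    exact hk

variable {LA : Language A} {LB : Language B}

theorem mem_omegaPower_sumExt_of_isLeft (hA : HasTails LA) (hB : HasTails LB) {x : ℕ → A ⊕ B}
    {k : ℕ} (h0 : (x 0).isLeft = true) (hk : (x k).isRight = true) :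
    x ∈ omegaPower (sumExt LA LB) := by
  obtain ⟨j, hj⟩ := hA.sumExt hB (tl x (k + 1))
  rw [tl_tl] at hj
  exact mem_omegaPower_iff.2
    ⟨k + 1 + j, by omega, pre_mem_sumExt_of_isLeft h0 hk (by omega), hj⟩

theorem mem_omegaPower_sumExt_of_pre (hA : HasTails LA) (hB : HasTails LB) {x : ℕ → A ⊕ B}
    {k : ℕ} (hk : 0 < k) {u : List B} (hu : u ∈ LB) (hxu : pre x k = u.map Sum.inr)
    (hxk : (x k).isLeft = true) : x ∈ omegaPower (sumExt LA LB) := by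
  obtain ⟨j, hj⟩ := hA.sumExt hB (tl x (k + 1))
  rw [tl_tl] at hj
  refine mem_omegaPower_iff.2 ⟨k + 1 + j, by omega, Or.inl (Or.inr ⟨?_, Or.inr
    ⟨u, x k, pre (tl x (k + 1)) j, hu, ?_, ?_⟩⟩), hj⟩
  · rw [show k + 1 + j = k + j + 1 by omega, pre_succ]
    exact ⟨_, _, trivial, isRight_of_pre_eq_map hxu hk, rfl⟩
  · rintro ⟨b, hb⟩
    rw [← hb] at hxk
    cases hxk
  · rw [pre_add, pre_succ_append, hxu]
    simp

/-- The shape of a factorization of a word of the `ω`-power that starts in `B` and meets `A`. -/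
theorem exists_pre_of_mem_omegaPower_sumExt {x : ℕ → A ⊕ B} {k : ℕ}
    (hx : x ∈ omegaPower (sumExt LA LB)) (hr : ∀ i < k, (x i).isRight = true) (hk : 0 < k)
    (hxk : (x k).isLeft = true) :
    ∃ m ≤ k, 0 < m ∧ (∃ u ∈ LB, pre x m = u.map Sum.inr) ∧
      (m < k → tl x m ∈ omegaPower (sumExt LA LB)) := by
  obtain ⟨m, hm, hL, ht⟩ := mem_omegaPower_iff.1 hx
  have h0 := hr 0 hk
  rcases hL with (⟨u, hu, h⟩ | ⟨-, ⟨u, hu, h⟩ | ⟨u, y, v, hu, hy, h⟩⟩) | ⟨⟨y, v, -, hy, h⟩, -⟩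
  · have := isLeft_of_pre_eq_map h hm
    cases hx0 : x 0 <;> simp_all
  · refine ⟨m, ?_, hm, ⟨u, hu, h⟩, fun _ => ht⟩
    by_contra hmk
    have := isRight_of_pre_eq_map h (i := k) (by omega)
    cases hx0 : x k <;> simp_all
  · have hlen : u.length < m := by
      have := congrArg List.length h
      simp at this
      omega
    have hsplit : pre x m = pre x u.length ++ pre (tl x u.length) (m - u.length) := by
      rw [← pre_add, Nat.add_sub_cancel' hlen.le]
    rw [hsplit] at h
    obtain ⟨h1, h2⟩ := List.append_inj h (by simp)
    obtain ⟨l, hl⟩ : ∃ l, m - u.length = l + 1 := ⟨m - u.length - 1, by omega⟩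
    rw [hl, pre_succ, List.cons.injEq] at h2
    have hxu : x u.length = y := by simpa using h2.1
    have huk : u.length = k := by
      rcases lt_trichotomy u.length k with hlt | heq | hgt
      · obtain ⟨b, hb⟩ := Sum.isRight_iff.1 (hr _ hlt)
        exact absurd ⟨b, by rw [← hxu, hb]⟩ hy
      · exact heq
      · have := isRight_of_pre_eq_map h1 hgt
        cases hx0 : x k <;> simp_all
    exact ⟨u.length, huk.le, by omega, ⟨u, hu, h1⟩, fun h => by omega⟩
  · cases m with
    | zero => omega
    | succ m =>
      rw [pre_succ, List.cons.injEq] at h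
      obtain ⟨b, hb⟩ := Sum.isRight_iff.1 h0
      rw [← h.1, hb] at hy
      cases hy

/-- The factors before the first letter of `A` are words of `LB`. The one that reaches position `k`
can be prolonged through any continuation to a good tail. -/
theorem mem_omegaPower_sumExt_congr (hA : HasTails LA) (hB : HasTails LB) (k : ℕ)
    (x x' : ℕ → A ⊕ B) (hx : x ∈ omegaPower (sumExt LA LB))
    (hr : ∀ i < k, (x i).isRight = true) (hk : 0 < k) (hxk : (x k).isLeft = true)
    (heq : ∀ i < k + 1, x' i = x i) : x' ∈ omegaPower (sumExt LA LB) := by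
  induction k using Nat.strong_induction_on generalizing x x' with
  | _ k ih =>
    obtain ⟨m, hmk, hm, ⟨u, hu, hxu⟩, ht⟩ := exists_pre_of_mem_omegaPower_sumExt hx hr hk hxk
    have hxu' : pre x' m = u.map Sum.inr := by
      rw [← hxu]; exact pre_congr fun i hi => heq i (by omega)
    rcases hmk.lt_or_eq with hlt | rfl
    · refine mem_omegaPower_iff.2 ⟨m, hm, Or.inl (Or.inr ⟨?_, Or.inl ⟨u, hu, hxu'⟩⟩), ?_⟩
      · obtain ⟨l, rfl⟩ : ∃ l, m = l + 1 := ⟨m - 1, by omega⟩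
        rw [pre_succ]
        exact ⟨_, _, trivial, isRight_of_pre_eq_map hxu' hm, rfl⟩
      · refine ih (k - m) (by omega) (tl x m) _ (ht hlt) (fun i hi => hr _ (by omega))
          (by omega) ?_ fun i hi => heq _ (by omega)
        rwa [tl_apply, Nat.add_sub_cancel' hmk]
    · exact mem_omegaPower_sumExt_of_pre hA hB hm hu hxu' (by rwa [heq m (by omega)])

/-- The part before the first letter of `A` is a product of words of `LB`; continuing it by `y₀`
gives `y`. -/
theorem exists_mem_omegaPower_of_sumExt {y₀ : ℕ → B} (hy₀ : y₀ ∈ omegaPower LB) (k : ℕ)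
    (x : ℕ → A ⊕ B) (hx : x ∈ omegaPower (sumExt LA LB))
    (hr : ∀ i < k, (x i).isRight = true) (hk : 0 < k) (hxk : (x k).isLeft = true) :
    ∃ y ∈ omegaPower LB, ∀ i < k, x i = Sum.inr (y i) := by
  induction k using Nat.strong_induction_on generalizing x with
  | _ k ih =>
    obtain ⟨m, hmk, hm, ⟨u, hu, hxu⟩, ht⟩ := exists_pre_of_mem_omegaPower_sumExt hx hr hk hxk
    obtain ⟨z, hz, hzx⟩ : ∃ z ∈ omegaPower LB, ∀ i < k - m, x (m + i) = Sum.inr (z i) := by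
      rcases hmk.lt_or_eq with hlt | rfl
      · refine ih (k - m) (by omega) (tl x m) (ht hlt) (fun i hi => hr _ (by omega))
          (by omega) ?_
        rwa [tl_apply, Nat.add_sub_cancel' hmk]
      · exact ⟨y₀, hy₀, fun i hi => by omega⟩
    let r : A ⊕ B → B := Sum.elim (fun _ => y₀ 0) id
    have hrr : ∀ c : A ⊕ B, c.isRight = true → c = Sum.inr (r c) := by
      rintro (a | b) h
      · cases h
      · rfl
    refine ⟨fun i => if i < m then r (x i) else z (i - m), ?_, ?_⟩
    · refine mem_omegaPower_iff.2 ⟨m, hm, ?_, ?_⟩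
      · have : pre (fun i => if i < m then r (x i) else z (i - m)) m = pre (r ∘ x) m :=
          pre_congr fun i hi => by simp [hi]
        rw [this, ← map_pre, hxu, List.map_map]
        have : r ∘ Sum.inr = id := rfl
        rwa [this, List.map_id]
      · convert hz using 1
        ext i
        simp
    · intro i hi
      dsimp only
      split_ifs with him
      · exact hrr _ (hr i hi)
      · rw [← hzx _ (by omega), Nat.add_sub_cancel' (by omega)]

theorem exists_first {p : ℕ → Prop} (h : ∃ n, p n) : ∃ n, p n ∧ ∀ i < n, ¬p i := by
  classical
  exact ⟨Nat.find h, Nat.find_spec h, fun i hi => Nat.find_min h hi⟩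

theorem exists_first_isLeft {x : ℕ → A ⊕ B} (h0 : (x 0).isLeft = false)
    (hx : x ∉ range (inrSeq A)) :
    ∃ k, 0 < k ∧ (x k).isLeft = true ∧ ∀ i < k, (x i).isRight = true := by
  rw [mem_range_inrSeq] at hx
  push Not at hx
  obtain ⟨k, hk, hmin⟩ := exists_first (p := fun k => (x k).isLeft = true) (by simpa using hx)
  refine ⟨k, ?_, hk, fun i hi => by simpa using hmin i hi⟩
  rcases Nat.eq_zero_or_pos k with rfl | h
  · simp [h0] at hk
  · exact h

variable [TopologicalSpace A] [DiscreteTopology A] [TopologicalSpace B] [DiscreteTopology B]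

theorem isClosedEmbedding_inrSeq : IsClosedEmbedding (inrSeq A : (ℕ → B) → _) :=
  isClosedEmbedding_comp Sum.inr_injective

/-- On this side all mixed words are in the ω-power, so they cannot serve as the outside endpoint of
a chain. -/
theorem altSet_sumExt_inter_left (hA : HasTails LA) (hB : HasTails LB) {n : ℕ} {b : Bool}
    (hb : lastVal b (n + 1) = false) (h : altSet (omegaPower LA) (n + 1) b = ∅) :
    altSet (omegaPower (sumExt LA LB)) (n + 1) b ∩ {x | (x 0).isLeft = true} = ∅ := by
  have hin : ∀ x : ℕ → A ⊕ B, (x 0).isLeft = true → x ∉ range (inlSeq B) →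
      x ∈ omegaPower (sumExt LA LB) := fun x h0 hx => by
    rw [mem_range_inlSeq] at hx
    push Not at hx
    obtain ⟨k, hk⟩ := hx
    exact mem_omegaPower_sumExt_of_isLeft hA hB h0 (k := k) (by simpa using hk)
  have hU : IsOpen {x : ℕ → A ⊕ B | (x 0).isLeft = true} :=
    (isClopen_first fun c : A ⊕ B => c.isLeft = true).isOpen
  refine altSet_inter_eq_empty (e := inlSeq B) isClosedEmbedding_inlSeq hU ?_ ?_ hb
    (by rwa [inlSeq_preimage_sumExt])
  · intro x hxU hx
    refine Or.inl (mem_of_superset ((hU.inter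
      isClosedEmbedding_inlSeq.isClosed_range.isOpen_compl).mem_nhds ⟨hxU, hx⟩) ?_)
    rintro y ⟨hy, hy'⟩
    exact hin y hy hy'
  · intro y hyU hy
    have hsub : {x | x ∈ omegaPower (sumExt LA LB) ↔ false = true} ∩
        {x : ℕ → A ⊕ B | (x 0).isLeft = true} ⊆
        inlSeq B '' {y | inlSeq B y ∈ omegaPower (sumExt LA LB) ↔ false = true} := by
      rintro x ⟨hx, hxU⟩
      have : x ∈ range (inlSeq B) := by
        by_contra hxr
        exact absurd (hx.1 (hin x hxU hxr)) (by simp)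
      obtain ⟨z, rfl⟩ := this
      exact ⟨z, hx, rfl⟩
    have h2 := closure_mono hsub (hU.closure_inter ⟨hy, hyU⟩)
    rw [isClosedEmbedding_inlSeq.closure_image_eq] at h2
    obtain ⟨z, hz, hzy⟩ := h2
    rwa [← isClosedEmbedding_inlSeq.injective hzy]

/-- On this side a mixed word in the ω-power agrees, up to its first letter of `A`, with a word of
the ω-power of `LB`. Inside endpoints can thus be replaced by words over `B`. -/
theorem altSet_sumExt_inter_right (hA : HasTails LA) (hB : HasTails LB)
    (hne : (omegaPower LB).Nonempty) {n : ℕ} {b : Bool} (hb : lastVal b (n + 1) = true)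
    (h : altSet (omegaPower LB) (n + 1) b = ∅) :
    altSet (omegaPower (sumExt LA LB)) (n + 1) b ∩ {x | (x 0).isLeft = false} = ∅ := by
  obtain ⟨y₀, hy₀⟩ := hne
  refine altSet_inter_eq_empty (e := inrSeq A) isClosedEmbedding_inrSeq
    (isClopen_first fun c : A ⊕ B => c.isLeft = false).isOpen ?_ ?_ hb
    (by rwa [inrSeq_preimage_sumExt])
  · intro x hxU hx
    obtain ⟨k, hk, hxk, hr⟩ := exists_first_isLeft hxU hx
    refine constNear_of_forall (k + 1) fun y hy => ⟨fun h => ?_, fun h => ?_⟩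
    · exact mem_omegaPower_sumExt_congr hA hB k y x h
        (fun i hi => by rw [hy i (by omega)]; exact hr i hi) hk
        (by rwa [hy k (by omega)]) fun i hi => (hy i hi).symm
    · exact mem_omegaPower_sumExt_congr hA hB k x y h hr hk hxk hy
  · intro y hyU hy
    rw [mem_closure_iff_pre] at hy ⊢
    intro n
    obtain ⟨x, hx, hxy⟩ := hy (n + 1)
    by_cases hxr : x ∈ range (inrSeq A)
    · obtain ⟨z, rfl⟩ := hxr
      exact ⟨z, hx, fun i hi => Sum.inr_injective (hxy i (by omega))⟩
    · obtain ⟨k, hk, hxk, hr⟩ := exists_first_isLeft (by rw [hxy 0 (by omega)]; exact hyU) hxr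
      obtain ⟨z, hz, hzx⟩ := exists_mem_omegaPower_of_sumExt hy₀ k x (hx.2 rfl) hr hk hxk
      have hnk : n < k := by
        by_contra hnk
        rw [hxy k (by omega)] at hxk
        cases hxk
      refine ⟨z, iff_of_true ?_ rfl, fun i hi => ?_⟩
      · rw [← inrSeq_preimage_sumExt LA LB] at hz; exact hz
      · refine Sum.inr_injective (α := A) ?_
        rw [← hzx i (by omega)]; exact hxy i (by omega)

end Sum

/-! ### Inductive construction and conclusion -/

section Main

/-- Some `ω`-power of a regular language over a finite alphabet has chains of `n` alternations
that start with the value `b`, but none that start with the value `!b`; moreover every word has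
a tail in this `ω`-power. -/
def Realizes (n : ℕ) (b : Bool) : Prop :=
  ∃ (A : Type) (_ : TopologicalSpace A) (_ : DiscreteTopology A) (_ : Finite A) (L : Language A),
    L.IsRegular ∧ HasTails L ∧ (altSet (omegaPower L) n b).Nonempty ∧
      altSet (omegaPower L) n (!b) = ∅

/-- The extension is chosen to supply the value opposite to the last value of the existing chain. -/
theorem Realizes.succ {n : ℕ} {b : Bool} (h : Realizes n b) : Realizes (n + 1) b := by
  obtain ⟨A, _, _, _, L, hL, hT, hne, hem⟩ := h
  cases hb : lastVal b n with
  | true =>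
    refine ⟨A ⊕ Bool, inferInstance, inferInstance, inferInstance, markExt L,
      isRegular_markExt hL, hT.markExt, ?_, ?_⟩
    · refine (hne.image (inlSeq Bool)).mono ?_
      rw [← inlSeq_preimage_markExt]
      refine altSet_image_subset_succ isClosedEmbedding_inlSeq.continuous
        inlSeq_mem_closure_compl_markExt n b hb
    · refine subset_empty_iff.1 ((altSet_succ_subset_image isClosedEmbedding_inlSeq
        (fun _ => constNear_markExt hT) n _).trans ?_)
      rw [inlSeq_preimage_markExt, hem, image_empty]
  | false =>
    refine ⟨A ⊕ Unit, inferInstance, inferInstance, inferInstance, acceptExt L,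
      isRegular_acceptExt hL, hT.acceptExt, ?_, ?_⟩
    · refine (hne.image (inlSeq Unit)).mono ?_
      rw [← inlSeq_preimage_acceptExt]
      refine altSet_image_subset_succ isClosedEmbedding_inlSeq.continuous
        (inlSeq_mem_closure_acceptExt hT) n b hb
    · refine subset_empty_iff.1 ((altSet_succ_subset_image isClosedEmbedding_inlSeq
        (fun _ => constNear_acceptExt hT) n _).trans ?_)
      rw [inlSeq_preimage_acceptExt, hem, image_empty]

theorem realizes_zero_true : Realizes 0 true := by
  have h : omegaPower (⊤ : Language Unit) = univ :=
    univ_subset_iff.1 (subset_omegaPower fun σ _ => ⟨1, one_pos, trivial, trivial⟩)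
  refine ⟨Unit, inferInstance, inferInstance, inferInstance, ⊤, isRegular_top,
    fun σ => ⟨0, by rw [h]; trivial⟩, ⟨fun _ => (), ?_⟩, ?_⟩
  · rw [h]; simp [altSet]
  · rw [h]; simp [altSet]

theorem realizes_dual (n : ℕ) : Realizes n true := by
  induction n with
  | zero => exact realizes_zero_true
  | succ n ih => exact ih.succ

theorem hasTails_empty : HasTails (⊤ : Language Empty) := fun σ => (σ 0).elim

/-- Over an empty base alphabet every word contains a marker, so the ω-power of `markExt ⊤` is
clopen and its complement is nonempty. Under `acceptExt` this complement stays closed but becomes a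
limit of members. The case of length zero cannot start the induction, since an empty ω-power over a
nonempty alphabet violates `HasTails`. -/
theorem realizes_one_false : Realizes 1 false := by
  have hT := (hasTails_empty).markExt
  refine ⟨(Empty ⊕ Bool) ⊕ Unit, inferInstance, inferInstance, inferInstance,
    acceptExt (markExt ⊤), isRegular_acceptExt (isRegular_markExt isRegular_top), hT.acceptExt,
    ?_, ?_⟩
  · let y : ℕ → Empty ⊕ Bool := fun i => Sum.inr (decide (0 < i))
    have hy : y ∉ omegaPower (markExt ⊤) := notMem_omegaPower_markExt 0 y (by simp) rfl rfl
    refine ⟨inlSeq Unit y, ?_, ?_⟩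
    · rw [mem_ofPred_eq, inlSeq_mem_omegaPower_acceptExt]
      exact iff_of_false hy (by simp)
    · refine closure_mono ?_ (inlSeq_mem_closure_acceptExt hT y)
      exact fun x hx => ⟨fun _ => rfl, fun _ => hx.2 rfl⟩
  · rw [eq_empty_iff_forall_notMem]
    intro x hx
    have hxr : x ∈ range (inlSeq Unit) := by
      by_contra hxr
      exact (constNear_acceptExt hT hxr).notMem_altSet_succ 0 _ hx
    obtain ⟨y, rfl⟩ := hxr
    have hyr : y ∉ range (inlSeq Bool) := by
      rintro ⟨z, -⟩
      exact (z 0).elim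
    have hy : y ∈ omegaPower (markExt (⊤ : Language Empty)) :=
      (inlSeq_mem_omegaPower_acceptExt y).1 (hx.1.2 rfl)
    have hsub : altSet (omegaPower (acceptExt (markExt (⊤ : Language Empty)))) 0 (!!false) ⊆
        inlSeq Unit '' (omegaPower (markExt (⊤ : Language Empty)))ᶜ := by
      intro x hx
      have hx' : x ∉ omegaPower (acceptExt (markExt (⊤ : Language Empty))) :=
        fun h => Bool.false_ne_true (hx.1 h)
      have hxr : x ∈ range (inlSeq Unit) := by
        by_contra hxr
        exact hx' (mem_omegaPower_acceptExt_of_notMem_range hT hxr)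
      obtain ⟨z, rfl⟩ := hxr
      exact ⟨z, fun h => hx' ((inlSeq_mem_omegaPower_acceptExt z).2 h), rfl⟩
    have hcl := closure_mono hsub hx.2
    rw [isClosedEmbedding_inlSeq.closure_image_eq] at hcl
    obtain ⟨z, hz, hzy⟩ := hcl
    rw [isClosedEmbedding_inlSeq.injective hzy] at hz
    rcases constNear_markExt hasTails_empty hyr with h | h
    · obtain ⟨w, hw, hw'⟩ := mem_closure_iff_nhds.1 hz _ h
      exact hw' hw
    · exact mem_of_mem_nhds h hy

theorem realizes_odd (n : ℕ) : Realizes (n + 1) false := by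
  induction n with
  | zero => exact realizes_one_false
  | succ n ih => exact ih.succ

theorem Realizes.exists_bool {n : ℕ} {b : Bool} (h : Realizes n b) :
    ∃ L : Language Bool, L.IsRegular ∧ (altSet (omegaPower L) n b).Nonempty ∧
      altSet (omegaPower L) n (!b) = ∅ := by
  obtain ⟨A, _, _, _, L, hL, -, hne, hem⟩ := h
  have : Nonempty A := hne.elim fun x _ => ⟨x 0⟩
  obtain ⟨h, hc, ho, hs, hh⟩ := encodes_bool A
  obtain ⟨L', hL', hLL'⟩ := hh L hL
  refine ⟨L', hL', ?_, ?_⟩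
  · rw [hLL', altSet_preimage ho hc]; exact hne.preimage hs
  · rw [hLL', altSet_preimage ho hc, hem, preimage_empty]

theorem exists_isCompleteFor_dClass (n : ℕ) : ∃ L : Language Bool, L.IsRegular ∧
    IsCompleteFor (dClass n) (omegaPower L) := by
  cases n with
  | zero =>
    have h : omegaPower (⊤ᶜ : Language Bool) = ∅ := by
      rw [eq_empty_iff_forall_notMem]
      intro σ hσ
      obtain ⟨m, -, hL, -⟩ := mem_omegaPower_iff.1 hσ
      exact hL trivial
    refine ⟨⊤ᶜ, isRegular_top.compl, isCompleteFor_dClass ?_ ?_⟩ <;> rw [h]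
    · exact ⟨fun _ => true, by simp [altSet]⟩
    · simp [altSet]
  | succ n =>
    obtain ⟨L, hL, hne, hem⟩ := (realizes_odd n).exists_bool
    exact ⟨L, hL, isCompleteFor_dClass hne hem⟩

theorem exists_isCompleteFor_dual_dClass (n : ℕ) : ∃ L : Language Bool, L.IsRegular ∧
    IsCompleteFor (dual (dClass n)) (omegaPower L) := by
  obtain ⟨L, hL, hne, hem⟩ := (realizes_dual n).exists_bool
  exact ⟨L, hL, isCompleteFor_dual_dClass hne hem⟩

theorem exists_isCompleteFor_oplus_of_clopen {A : Type} [TopologicalSpace A] [DiscreteTopology A]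
    [Finite A] {L : Language A} (hL : L.IsRegular) {C : Set (ℕ → A)} {n : ℕ} (hC : IsClopen C)
    (ht : (altSet (omegaPower L) n true).Nonempty)
    (hf : (altSet (omegaPower L) n false).Nonempty)
    (ht' : altSet (omegaPower L) n true ∩ C = ∅)
    (hf' : altSet (omegaPower L) n false ∩ Cᶜ = ∅) :
    ∃ L : Language Bool, L.IsRegular ∧
      IsCompleteFor (oplus (dClass n) (dual (dClass n))) (omegaPower L) := by
  have : Nonempty A := ht.elim fun x _ => ⟨x 0⟩
  obtain ⟨h, hc, ho, hs, hh⟩ := encodes_bool A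
  obtain ⟨L', hL', hLL'⟩ := hh L hL
  refine ⟨L', hL', isCompleteFor_oplus (C := h ⁻¹' C) (hC.preimage hc) ?_ ?_ ?_ ?_⟩ <;>
    rw [hLL', altSet_preimage ho hc]
  · exact ht.preimage hs
  · exact hf.preimage hs
  · rw [← preimage_inter, ht', preimage_empty]
  · rw [← preimage_compl, ← preimage_inter, hf', preimage_empty]

theorem exists_isCompleteFor_oplus_zero : ∃ L : Language Bool, L.IsRegular ∧
    IsCompleteFor (oplus (dClass 0) (dual (dClass 0))) (omegaPower L) := by
  have hL : (markExt (⊤ : Language Empty)).IsRegular := isRegular_markExt isRegular_top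
  have hS : IsClopen (omegaPower (markExt (⊤ : Language Empty))) := by
    have hconst : ∀ x, ConstNear (omegaPower (markExt (⊤ : Language Empty))) x := fun x =>
      constNear_markExt hasTails_empty (by rintro ⟨z, -⟩; exact (z 0).elim)
    constructor
    · rw [← isOpen_compl_iff, isOpen_iff_mem_nhds]
      exact fun x hx => (hconst x).resolve_left fun h => hx (mem_of_mem_nhds h)
    · rw [isOpen_iff_mem_nhds]
      exact fun x hx => (hconst x).resolve_right fun h => mem_of_mem_nhds h hx
  -- Chains of length zero only record membership, so the complement of the clopen ω-power separates
  -- the two kinds.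
  refine exists_isCompleteFor_oplus_of_clopen hL hS.compl ?_ ?_ ?_ ?_
  · refine ⟨fun _ => Sum.inr true, iff_of_true ?_ rfl⟩
    exact MarkStart.mem_omegaPower hasTails_empty (Or.inl rfl)
  · refine ⟨fun i => Sum.inr (decide (0 < i)), iff_of_false ?_ Bool.false_ne_true⟩
    exact notMem_omegaPower_markExt 0 _ (by simp) rfl rfl
  · ext x; simp [altSet]
  · ext x; simp [altSet]

theorem exists_isCompleteFor_oplus (n : ℕ) : ∃ L : Language Bool, L.IsRegular ∧
    IsCompleteFor (oplus (dClass (2 * n + 1)) (dual (dClass (2 * n + 1)))) (omegaPower L) := by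
  obtain ⟨A, _, _, _, LA, hLA, hTA, hneA, hemA⟩ := realizes_odd (2 * n)
  obtain ⟨B, _, _, _, LB, hLB, hTB, hneB, hemB⟩ := realizes_dual (2 * n + 1)
  have hLBne : (omegaPower LB).Nonempty :=
    hneB.mono fun x hx => (altSet_subset _ _ _ hx).2 rfl
  refine exists_isCompleteFor_oplus_of_clopen (isRegular_sumExt hLA hLB)
    (isClopen_first fun c : A ⊕ B => c.isLeft = true) ?_ ?_
    -- Since `2 * n + 1` is odd, chains that start inside end outside, and conversely, as the two
    -- sides of `sumExt` require.
    (altSet_sumExt_inter_left hTA hTB (by simp [lastVal]) hemA) ?_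
  · refine (hneB.image (inrSeq A)).mono ?_
    rw [← inrSeq_preimage_sumExt LA LB]
    exact altSet_image_subset isClosedEmbedding_inrSeq.continuous _ _ _
  · refine (hneA.image (inlSeq B)).mono ?_
    rw [← inlSeq_preimage_sumExt LA LB]
    exact altSet_image_subset isClosedEmbedding_inlSeq.continuous _ _ _
  · have := altSet_sumExt_inter_right hTA hTB hLBne (by simp [lastVal]) hemB
    rw [← this]
    congr 1
    ext x
    simp

end Main

end OmegaPower

theorem mainTheorem1 (n : ℕ) :
    (∃ L : Language Bool, L.IsRegular ∧
      OmegaPower.IsCompleteFor (OmegaPower.dClass n) (OmegaPower.omegaPower L)) ∧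
    (∃ L : Language Bool, L.IsRegular ∧
      OmegaPower.IsCompleteFor (OmegaPower.dual (OmegaPower.dClass n))
        (OmegaPower.omegaPower L)) ∧
    (∃ L : Language Bool, L.IsRegular ∧
      OmegaPower.IsCompleteFor
        (OmegaPower.oplus (OmegaPower.dClass 0) (OmegaPower.dual (OmegaPower.dClass 0)))
        (OmegaPower.omegaPower L)) ∧
    (∃ L : Language Bool, L.IsRegular ∧
      OmegaPower.IsCompleteFor
        (OmegaPower.oplus (OmegaPower.dClass (2 * n + 1))
          (OmegaPower.dual (OmegaPower.dClass (2 * n + 1))))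
        (OmegaPower.omegaPower L)) :=
  ⟨OmegaPower.exists_isCompleteFor_dClass n, OmegaPower.exists_isCompleteFor_dual_dClass n,
    OmegaPower.exists_isCompleteFor_oplus_zero, OmegaPower.exists_isCompleteFor_oplus n⟩
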